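/- Let $n\ge 1$ and let $\omega$ be a weight on $\mathbb R^n$, i.e. a nonnegative locally integrable function; write $\omega(E)=\int_E\omega\,dx$. For a measurable $f:\mathbb R^n\to[0,\infty]$ let $f^*(t)=\inf\{s>0:\omega(\{f>s\})\le t\}$ be its decreasing rearrangement with respect to $\omega\,dx$, and, for $0<p<\infty$, put $$\|f\|_{L^{p,q}(\omega)}=\Big(\tfrac qp\int_0^\infty\big[t^{1/p}f^*(t)\big]^q\,\tfrac{dt}{t}\Big)^{1/q}\ (0<q<\infty),\qquad \|f\|_{L^{p,\infty}(\omega)}=\sup_{t>0}t^{1/p}f^*(t).$$ For $1<r<\infty$ and a sequence $\vec f=\{f_k\}_{k\ge1}$ of measurable functions put $|\vec f(x)|_r=\big(\sum_k|f_k(x)|^r\big)^{1/r}$ and $\|\vec f\|_{L^{p,q}(\ell^r,\omega)}=\big\||\vec f|_r\big\|_{L^{p,q}(\omega)}$; $L^{p,q}(\ell^r,\omega)$ is the set of those $\vec f$ for which this is finite. Cubes have sides parallel to the coordinate axes. Let $Mf(x)=\sup_Q\frac1{|Q|}\int_Q|f(y)|\,dy$, the supremum being over all cubes $Q$ centred at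 $x$, and $M(\vec f)=\{Mf_k\}$. For $1<p<\infty$ we write $\omega\in A(p,1)$ if there is a constant $C>0$ such that for every cube $Q$ $$\|\chi_Q\|_{L^{p,1}(\omega)}\,\|\chi_Q\,\omega^{-1}\|_{L^{p',\infty}(\omega)}\le C|Q|,\qquad \tfrac1p+\tfrac1{p'}=1$$ (with $\omega^{-1}=\infty$ where $\omega=0$). Theorem. Let $1<p,r<\infty$. Consider the statement $$(\ast)\qquad \text{there is } C>0 \text{ such that } \|M(\vec f)\|_{L^{p,\infty}(\ell^r,\omega)}\le C\,\|\vec f\|_{L^{p,1}(\ell^r,\omega)}\quad\text{for all }\vec f\in L^{p,1}(\ell^r,\omega).$$ If $(\ast)$ holds, then $\omega\in A(p,1)$. Conversely, suppose that $\omega>0$ almost everywhere. Then: (i) if $\omega\in\bigcup_{1<q<p}A(q,1)$, then $(\ast)$ holds; (ii) if $p<r$ and $\omega\in A(p,1)$, then $(\ast)$ holds. -/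

import Mathlib

open MeasureTheory Set
open scoped ENNReal NNReal

noncomputable section

namespace WeightedLorentz

/-- The closed cube in `ℝⁿ` with centre `c`, side length `2 * h` and sides parallel to the axes. -/
def cube {n : ℕ} (c : Fin n → ℝ) (h : ℝ) : Set (Fin n → ℝ) :=
  {y | ∀ i, |y i - c i| ≤ h}

/-- A weight function: a nonnegative locally integrable function on `ℝⁿ`. -/
structure IsWeight {n : ℕ} (ω : (Fin n → ℝ) → ℝ) : Prop where
  nonneg : ∀ x, 0 ≤ ω x
  locallyIntegrable : LocallyIntegrable ω volume

/-- The measure `ω(x) dx`. -/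
def weightMeasure {n : ℕ} (ω : (Fin n → ℝ) → ℝ) : Measure (Fin n → ℝ) :=
  volume.withDensity fun x => ENNReal.ofReal (ω x)

/-- The distribution function `d_F(s) = μ {x | F x > s}` of a nonnegative function. -/
def distribution {X : Type*} [MeasurableSpace X] (μ : Measure X) (F : X → ℝ≥0∞) (s : ℝ≥0∞) :
    ℝ≥0∞ :=
  μ {x | s < F x}

/-- The decreasing rearrangement `F*(t) = inf {s > 0 | d_F(s) ≤ t}`. -/
def rearrangement {X : Type*} [MeasurableSpace X] (μ : Measure X) (F : X → ℝ≥0∞) (t : ℝ≥0∞) :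
    ℝ≥0∞ :=
  sInf {s | 0 < s ∧ distribution μ F s ≤ t}

/-- The Lorentz quasi-norm `‖F‖_{p,q}` of a nonnegative (possibly infinite) function, namely
`((q/p) ∫₀^∞ (t^{1/p} F*(t))^q dt/t)^{1/q}` if `q < ∞`, and `sup_{t > 0} t^{1/p} F*(t)`
if `q = ∞`. For `p = ∞` the exponent `1/p` is `0`. -/
def lorentzNorm {X : Type*} [MeasurableSpace X] (μ : Measure X) (p q : ℝ≥0∞) (F : X → ℝ≥0∞) :
    ℝ≥0∞ :=
  if q = ⊤ then
    ⨆ t : ℝ, ⨆ _ : 0 < t,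
      ENNReal.ofReal t ^ (1 / p).toReal * rearrangement μ F (ENNReal.ofReal t)
  else
    (q / p * ∫⁻ t in Ioi (0 : ℝ),
      (ENNReal.ofReal t ^ (1 / p).toReal * rearrangement μ F (ENNReal.ofReal t)) ^ q.toReal
        / ENNReal.ofReal t) ^ (1 / q).toReal

/-- The class `A(p,q)`: `‖χ_Q‖_{p,q} ‖χ_Q ω⁻¹‖_{p',q'} ≤ C |Q|` for all cubes `Q`, where the
Lorentz norms are with respect to `ω(x) dx`, `1/p + 1/p' = 1/q + 1/q' = 1`, and `ω⁻¹ = ∞`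
where `ω = 0`. -/
def MemA {n : ℕ} (p q : ℝ≥0∞) (ω : (Fin n → ℝ) → ℝ) : Prop :=
  ∃ C : ℝ≥0, 0 < C ∧ ∀ (c : Fin n → ℝ) (h : ℝ), 0 < h →
    lorentzNorm (weightMeasure ω) p q ((cube c h).indicator fun _ => 1) *
      lorentzNorm (weightMeasure ω) p.conjExponent q.conjExponent
        ((cube c h).indicator fun x => (ENNReal.ofReal (ω x))⁻¹) ≤
    C * volume (cube c h)

/-- The Hardy–Littlewood maximal function `Mf(x)`: the supremum of the averages of `|f|` over
all cubes centred at `x`. -/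
def maximal {n : ℕ} (f : (Fin n → ℝ) → ℂ) (x : Fin n → ℝ) : ℝ≥0∞ :=
  ⨆ h : ℝ, ⨆ _ : 0 < h, (volume (cube x h))⁻¹ * ∫⁻ y in cube x h, ‖f y‖ₑ

/-- The `ℓ^r` norm `(∑ₖ aₖ^r)^{1/r}` of a sequence of nonnegative extended reals. -/
def ellNorm (r : ℝ) (a : ℕ → ℝ≥0∞) : ℝ≥0∞ :=
  (∑' k, a k ^ r) ^ (1 / r)

/-- `‖f‖_{L^{p,q}(ℓ^r, ω)}` for a sequence `f` of functions on `ℝⁿ`. -/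
def vectorLorentzNorm {n : ℕ} (p q : ℝ≥0∞) (r : ℝ) (ω : (Fin n → ℝ) → ℝ)
    (f : ℕ → (Fin n → ℝ) → ℂ) : ℝ≥0∞ :=
  lorentzNorm (weightMeasure ω) p q fun x => ellNorm r fun k => ‖f k x‖ₑ

/-- `‖M(f)‖_{L^{p,q}(ℓ^r, ω)}`, where `M(f) = {M fₖ}` for `f = {fₖ}`. -/
def vectorLorentzNormMaximal {n : ℕ} (p q : ℝ≥0∞) (r : ℝ) (ω : (Fin n → ℝ) → ℝ)
    (f : ℕ → (Fin n → ℝ) → ℂ) : ℝ≥0∞ :=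
  lorentzNorm (weightMeasure ω) p q fun x => ellNorm r fun k => maximal (f k) x

/-- `f ∈ L^{p,q}(ℓ^r, ω)`: a sequence of Lebesgue measurable functions with finite norm. -/
def MemVectorLorentz {n : ℕ} (p q : ℝ≥0∞) (r : ℝ) (ω : (Fin n → ℝ) → ℝ)
    (f : ℕ → (Fin n → ℝ) → ℂ) : Prop :=
  (∀ k, AEMeasurable (f k) volume) ∧ vectorLorentzNorm p q r ω f < ⊤

/-- The maximal operator is bounded from `L^{p,1}(ℓ^r, ω)` to `L^{p,∞}(ℓ^r, ω)`. -/
def MaximalBounded {n : ℕ} (p : ℝ≥0∞) (r : ℝ) (ω : (Fin n → ℝ) → ℝ) : Prop :=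
  ∃ C : ℝ≥0, 0 < C ∧ ∀ f : ℕ → (Fin n → ℝ) → ℂ, MemVectorLorentz p 1 r ω f →
    vectorLorentzNormMaximal p ⊤ r ω f ≤ C * vectorLorentzNorm p 1 r ω f

end WeightedLorentz

end

/-!
The weighted estimates are proved on translated dyadic grids. A centred cube lies in a cell of
comparable size of one of finitely many such grids (the one-third trick,
`exists_cube_subset_cell`), so that it suffices to bound dyadic maximal functions with finitely many
levels, uniformly in the grid (`maximalBounded_of_grid`). The weight enters through a single
inequality, equivalent to `A(p,1)` for positive weights:
`|E| ω(Q)^{1/p} ≤ K |Q| ω(E)^{1/p}` for measurable `E ⊆ Q`. One direction is the Hölder inequality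
between `L^{p,1}` and `L^{p',∞}` (`MemA.exists_comparable`), the other is a test on the sets where
`ω⁻¹` is large (`memA_of_comparable`). The boundedness of the maximal operator gives this inequality
by testing on `(χ_E, 0, 0, …)`, which proves necessity (`memA_of_maximalBounded`).

For sufficiency, write `|f|_r` for the `ℓ^r` norm of the sequence. The `ℓ^r`-valued dyadic maximal
function satisfies the unweighted weak-type `(1,1)` inequality, by a Calderón–Zygmund stopping
argument and Doob's inequality in `L^r` (`Grid.mul_meas_lt_tsum_maxAvg_le`). Iterating this
inequality on stopping cells gives a pointwise sparse domination: the `r`-th power of the maximal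
function is at most a constant times `∑ (avg_Q |f|_r)^r χ_Q` over selected cells `Q`
(`Grid.tsum_maxAvg_le_sum_sel`), and the part of a selected cell that meets no later selected cell
has at least half its measure (`Grid.measure_cell_le_two_mul`), hence a fixed proportion of its
weight. Sums over selected cells are therefore controlled by integrals against `ω` of maximal
functions (`Grid.sum_setLIntegral_sel_le`).

If `p < r`, the set where the scalar maximal function of `|f|_r` exceeds the height is controlled by
its weak-type bound, and off this set the `r`-th powers of the selected averages are integrable
(`Grid.exists_weak_bound_of_lt`). If `ω ∈ A(q,1)` with `q < p`, the sparse operator is dominated by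
the linear operator `∑ (avg_Q |f|_r) χ_Q`. Testing it on a set and decomposing `|f|_r` into its level
sets reduces the matter to characteristic functions, where averages with respect to Lebesgue measure
are at most `K` times the power `1/q` of weighted averages, and the weighted dyadic maximal operator
is bounded on `L^{p/q}(ω)` and `L^{p'}(ω)` (`Grid.exists_weak_bound_of_comparable_lt`).
-/

noncomputable section

namespace WeightedLorentz

/-! ### Power integrals and the layer cake formula -/

/-- `a ^ r = ∫_0^a r s^{r-1} ds`, also for `a = ∞`. -/
lemma lintegral_indicator_rpow_weight {r : ℝ} (hr : 0 < r) (a : ℝ≥0∞) :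
    ∫⁻ s in Ioi (0 : ℝ), {s : ℝ | ENNReal.ofReal s < a}.indicator
      (fun s => ENNReal.ofReal (r * s ^ (r - 1))) s = a ^ r := by
  have key : ∀ b : ℝ, 0 ≤ b → ∫⁻ s in Ioi (0 : ℝ), {s : ℝ | s < b}.indicator
      (fun s => ENNReal.ofReal (r * s ^ (r - 1))) s = ENNReal.ofReal b ^ r := by
    intro b hb
    have h := lintegral_rpow_eq_lintegral_meas_lt_mul (Measure.dirac ()) (f := fun _ => b)
      (ae_of_all _ fun _ => hb) aemeasurable_const hr
    simp only [lintegral_dirac] at h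
    rw [ENNReal.ofReal_rpow_of_nonneg hb hr.le, h,
      ← lintegral_const_mul' _ _ ENNReal.ofReal_ne_top]
    refine lintegral_congr fun s => ?_
    by_cases hs : s < b
    · simp [hs, ENNReal.ofReal_mul hr.le]
    · simp [hs]
  rcases eq_or_ne a ⊤ with rfl | ha
  · rw [ENNReal.top_rpow_of_pos hr]
    refine ENNReal.eq_top_of_forall_nnreal_le fun c => ?_
    have h := key ((c : ℝ) ^ (1 / r)) (by positivity)
    rw [ENNReal.ofReal_rpow_of_nonneg (by positivity) hr.le, ← Real.rpow_mul (NNReal.coe_nonneg c),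
      one_div_mul_cancel hr.ne', Real.rpow_one, ENNReal.ofReal_coe_nnreal] at h
    rw [← h]
    refine lintegral_mono fun s => ?_
    refine indicator_le_indicator_of_subset ?_ (fun _ => zero_le) s
    intro s _
    simp
  · have h := key a.toReal ENNReal.toReal_nonneg
    rw [ENNReal.ofReal_toReal ha] at h
    rw [← h]
    refine setLIntegral_congr_fun measurableSet_Ioi fun s hs => ?_
    have : ENNReal.ofReal s < a ↔ s < a.toReal := by
      rw [ENNReal.ofReal_lt_iff_lt_toReal (le_of_lt hs) ha]
    simp only [indicator, mem_ofPred_eq, this]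

/-- Fubini for the region under the graph of `φ`, with weight `w` in the vertical direction. -/
lemma lintegral_weight_mul_meas_lt {X : Type*} [MeasurableSpace X] {ν : Measure X} [SFinite ν]
    {φ : X → ℝ≥0∞} (hφ : Measurable φ) {w : ℝ → ℝ≥0∞} (hw : Measurable w) {g : X → ℝ≥0∞}
    (hg : Measurable g) :
    ∫⁻ s in Ioi (0 : ℝ), w s * ∫⁻ x in {x | ENNReal.ofReal s < φ x}, g x ∂ν =
      ∫⁻ x, g x * (∫⁻ s in Ioi (0 : ℝ), {s : ℝ | ENNReal.ofReal s < φ x}.indicator w s) ∂ν := by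
  have hset : MeasurableSet {z : ℝ × X | ENNReal.ofReal z.1 < φ z.2} :=
    measurableSet_lt (ENNReal.measurable_ofReal.comp measurable_fst) (hφ.comp measurable_snd)
  have hmeas : Measurable (fun z : ℝ × X =>
      {z : ℝ × X | ENNReal.ofReal z.1 < φ z.2}.indicator (fun z => w z.1 * g z.2) z) :=
    Measurable.indicator ((hw.comp measurable_fst).mul (hg.comp measurable_snd)) hset
  have hl : ∀ s : ℝ, w s * ∫⁻ x in {x | ENNReal.ofReal s < φ x}, g x ∂ν =
      ∫⁻ x, {z : ℝ × X | ENNReal.ofReal z.1 < φ z.2}.indicator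
        (fun z => w z.1 * g z.2) (s, x) ∂ν := by
    intro s
    rw [← lintegral_const_mul _ hg, ← lintegral_indicator (measurableSet_lt measurable_const hφ)]
    rfl
  simp_rw [hl]
  rw [lintegral_lintegral_swap (f := fun s x => {z : ℝ × X | ENNReal.ofReal z.1 < φ z.2}.indicator
        (fun z => w z.1 * g z.2) (s, x)) hmeas.aemeasurable]
  refine lintegral_congr fun x => ?_
  rw [← lintegral_const_mul]
  · refine lintegral_congr fun s => ?_
    by_cases h : ENNReal.ofReal s < φ x
    · simp [h, mul_comm]
    · simp [h]
  · exact hw.indicator (measurableSet_lt ENNReal.measurable_ofReal measurable_const)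

lemma lintegral_rpow_eq_lintegral_meas {X : Type*} [MeasurableSpace X] {ν : Measure X} [SFinite ν]
    {φ : X → ℝ≥0∞} (hφ : Measurable φ) {r : ℝ} (hr : 0 < r) :
    ∫⁻ x, φ x ^ r ∂ν =
      ∫⁻ s in Ioi (0 : ℝ), ENNReal.ofReal (r * s ^ (r - 1)) * ν {x | ENNReal.ofReal s < φ x} := by
  have h := lintegral_weight_mul_meas_lt (ν := ν) hφ (g := fun _ => 1)
    (w := fun s => ENNReal.ofReal (r * s ^ (r - 1))) (by fun_prop) measurable_const
  simp only [lintegral_one, Measure.restrict_apply_univ, one_mul,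
    lintegral_indicator_rpow_weight hr] at h
  exact h.symm

lemma lintegral_eq_lintegral_lintegral_indicator {X : Type*} [MeasurableSpace X] {ν : Measure X}
    [SFinite ν] {φ : X → ℝ≥0∞} (hφ : Measurable φ) :
    ∫⁻ x, φ x ∂ν =
      ∫⁻ s in Ioi (0 : ℝ), ∫⁻ x, {x | ENNReal.ofReal s < φ x}.indicator (fun _ => 1) x ∂ν := by
  have h := lintegral_rpow_eq_lintegral_meas (ν := ν) hφ one_pos
  simp only [ENNReal.rpow_one, sub_self, Real.rpow_zero, mul_one, ENNReal.ofReal_one, one_mul] at h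
  rw [h]
  refine lintegral_congr fun s => ?_
  rw [lintegral_indicator (measurableSet_lt measurable_const hφ)]
  simp

/-! ### Minkowski's inequality in `ℓ^r` -/

lemma ellNorm_rpow {r : ℝ} (hr : 0 < r) (a : ℕ → ℝ≥0∞) : ellNorm r a ^ r = ∑' k, a k ^ r := by
  rw [ellNorm, ← ENNReal.rpow_mul, one_div_mul_cancel hr.ne', ENNReal.rpow_one]

lemma le_ellNorm {r : ℝ} (hr : 0 < r) (a : ℕ → ℝ≥0∞) (k : ℕ) : a k ≤ ellNorm r a := by
  rw [← ENNReal.rpow_le_rpow_iff hr, ellNorm_rpow hr]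
  exact ENNReal.le_tsum k

lemma measurable_ellNorm {X : Type*} [MeasurableSpace X] {f : ℕ → X → ℝ≥0∞}
    (hf : ∀ k, Measurable (f k)) (r : ℝ) : Measurable fun x => ellNorm r fun k => f k x :=
  (Measurable.tsum fun k => (hf k).pow_const r).pow_const _

/-- Minkowski's integral inequality `‖∫ f‖_{ℓ^r} ≤ ∫ ‖f‖_{ℓ^r}`. -/
lemma tsum_lintegral_rpow_le {X : Type*} [MeasurableSpace X] {μ : Measure X}
    {f : ℕ → X → ℝ≥0∞} (hf : ∀ k, Measurable (f k)) {r : ℝ} (hr : 1 < r) :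
    ∑' k, (∫⁻ x, f k x ∂μ) ^ r ≤ (∫⁻ x, ellNorm r (fun k => f k x) ∂μ) ^ r := by
  have hr0 : 0 < r := by linarith
  have hle : ∀ k x, f k x ≤ ellNorm r (fun k => f k x) := fun k x =>
    le_ellNorm hr0 (fun k => f k x) k
  by_cases hfin : ∃ k, ∫⁻ x, f k x ∂μ = ⊤
  · obtain ⟨k, hk⟩ := hfin
    have : ∫⁻ x, ellNorm r (fun k => f k x) ∂μ = ⊤ :=
      top_le_iff.1 (hk ▸ lintegral_mono (hle k))
    rw [this, ENNReal.top_rpow_of_pos hr0]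
    exact le_top
  push Not at hfin
  rw [ENNReal.tsum_eq_iSup_sum]
  refine iSup_le fun s => ?_
  set a : ℕ → ℝ≥0∞ := fun k => ∫⁻ x, f k x ∂μ with ha
  set S := ∑ k ∈ s, a k ^ r with hS
  set N := ∫⁻ x, ellNorm r (fun k => f k x) ∂μ with hN
  have hSt : S ≠ ⊤ := ENNReal.sum_ne_top.2 fun k _ =>
    ENNReal.rpow_ne_top_of_nonneg hr0.le (hfin k)
  rcases eq_or_ne S 0 with h0 | h0
  · rw [h0]; exact zero_le
  have hconj : (r.conjExponent).HolderConjugate r := (Real.HolderConjugate.conjExponent hr).symm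
  -- pair with the extremal sequence `a ^ (r - 1)` and apply Hölder's inequality pointwise
  have h1 : S ≤ S ^ (1 / r.conjExponent) * N := by
    calc S = ∑ k ∈ s, a k ^ (r - 1) * a k := by
          refine Finset.sum_congr rfl fun k _ => ?_
          nth_rewrite 3 [← ENNReal.rpow_one (a k)]
          rw [← ENNReal.rpow_add_of_nonneg _ _ (by linarith) zero_le_one]
          congr 1; ring
      _ = ∫⁻ x, ∑ k ∈ s, a k ^ (r - 1) * f k x ∂μ := by
          rw [lintegral_finsetSum _ fun k _ => (hf k).const_mul _]
          exact Finset.sum_congr rfl fun k _ => (lintegral_const_mul _ (hf k)).symm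
      _ ≤ ∫⁻ x, S ^ (1 / r.conjExponent) * ellNorm r (fun k => f k x) ∂μ := by
          refine lintegral_mono fun x => ?_
          refine (ENNReal.inner_le_Lp_mul_Lq s _ _ hconj).trans ?_
          refine mul_le_mul' (le_of_eq ?_) ?_
          · rw [hS]
            congr 1
            refine Finset.sum_congr rfl fun k _ => ?_
            rw [← ENNReal.rpow_mul, hconj.symm.sub_one_mul_conj]
          · rw [ellNorm]
            exact ENNReal.rpow_le_rpow (ENNReal.sum_le_tsum s) (by positivity)
      _ = _ := lintegral_const_mul' _ _
          (ENNReal.rpow_ne_top_of_nonneg (one_div_nonneg.2 hconj.nonneg) hSt)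
  have h2 : S ^ (1 / r) ≤ N := by
    have hsplit : S = S ^ (1 / r.conjExponent) * S ^ (1 / r) := by
      rw [← ENNReal.rpow_add _ _ h0 hSt, one_div, one_div, hconj.inv_add_inv_eq_one,
        ENNReal.rpow_one]
    rw [hsplit] at h1
    have hne0 : S ^ (1 / r.conjExponent) ≠ 0 := by
      simp [ENNReal.rpow_eq_zero_iff, h0, hSt]
    have hnet : S ^ (1 / r.conjExponent) ≠ ⊤ :=
      ENNReal.rpow_ne_top_of_nonneg (one_div_nonneg.2 hconj.nonneg) hSt
    rw [← hsplit] at h1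
    nth_rewrite 1 [hsplit] at h1
    exact (ENNReal.mul_le_mul_iff_right hne0 hnet).1 h1
  calc S = (S ^ (1 / r)) ^ r := by
        rw [← ENNReal.rpow_mul, one_div_mul_cancel hr0.ne', ENNReal.rpow_one]
    _ ≤ N ^ r := ENNReal.rpow_le_rpow h2 hr0.le

lemma sum_rpow_le_rpow_sum {α : Type*} (s : Finset α) (a : α → ℝ≥0∞) {r : ℝ} (hr : 1 ≤ r) :
    ∑ i ∈ s, a i ^ r ≤ (∑ i ∈ s, a i) ^ r := by
  classical
  induction s using Finset.induction_on with
  | empty => simp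
  | insert i s hi ih =>
    rw [Finset.sum_insert hi, Finset.sum_insert hi]
    exact (add_le_add le_rfl ih).trans (ENNReal.add_rpow_le_rpow_add _ _ hr)

/-! ### Nested countable partitions and averages over their cells -/

/-- A nested sequence of measurable partitions of `X`. The partition of level `j` is given by the
labelling `idx j`, whose fibres are its cells; level `j + 1` refines level `j`. The partitions are
countable as soon as the type `ι` of labels is. -/
structure Grid (X ι : Type*) [MeasurableSpace X] where
  /-- The label of the cell of level `j` that contains the point. -/
  idx : ℕ → X → ι
  measurableSet_fiber : ∀ j i, MeasurableSet (idx j ⁻¹' {i})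
  nested : ∀ j x y, idx (j + 1) x = idx (j + 1) y → idx j x = idx j y

namespace Grid

variable {X ι : Type*} [MeasurableSpace X] (G : Grid X ι) {μ ν : Measure X}

/-- The cell of level `j` that contains `x`. -/
def cell (j : ℕ) (x : X) : Set X := {y | G.idx j y = G.idx j x}

/-- The average of `f` over the cell of level `j` that contains `x`. -/
def avg (μ : Measure X) (j : ℕ) (f : X → ℝ≥0∞) (x : X) : ℝ≥0∞ :=
  (μ (G.cell j x))⁻¹ * ∫⁻ y in G.cell j x, f y ∂μ

/-- The maximal function over the cells of levels `s, …, J`. -/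
def maxAvg (μ : Measure X) (s J : ℕ) (f : X → ℝ≥0∞) (x : X) : ℝ≥0∞ :=
  (Finset.Icc s J).sup fun i => G.avg μ i f x

/-- `φ` is constant on the cells of level `j`. -/
def IsLevel {α : Type*} (j : ℕ) (φ : X → α) : Prop :=
  ∀ x y, G.idx j x = G.idx j y → φ x = φ y

/-- `t` is a stopping time: whether `t x = j` depends on the cell of level `j` only. -/
def IsStopping (t : X → ℕ) : Prop :=
  ∀ x y, G.idx (t x) x = G.idx (t x) y → t y = t x

/-- The grid whose level `j` is level `m + j` of `G`. -/
def shift (m : ℕ) : Grid X ι where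
  idx j := G.idx (m + j)
  measurableSet_fiber j := G.measurableSet_fiber (m + j)
  nested j := G.nested (m + j)

variable {G}

lemma idx_eq_of_le {i j : ℕ} (hij : i ≤ j) {x y : X} (h : G.idx j x = G.idx j y) :
    G.idx i x = G.idx i y := by
  induction j, hij using Nat.le_induction with
  | base => exact h
  | succ j _ ih => exact ih (G.nested j x y h)

lemma cell_eq {j : ℕ} {x y : X} (h : G.idx j x = G.idx j y) : G.cell j x = G.cell j y := by
  simp [cell, h]

lemma isLevel_avg (j : ℕ) (f : X → ℝ≥0∞) : G.IsLevel j (G.avg μ j f) := by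
  intro x y h
  simp [avg, cell_eq h]

lemma IsLevel.mono {α : Type*} {i j : ℕ} (hij : i ≤ j) {φ : X → α} (h : G.IsLevel i φ) :
    G.IsLevel j φ :=
  fun x y hxy => h x y (idx_eq_of_le hij hxy)

lemma isLevel_maxAvg {s J : ℕ} (f : X → ℝ≥0∞) : G.IsLevel J (G.maxAvg μ s J f) := by
  intro x y h
  refine Finset.sup_congr rfl fun i hi => ?_
  exact isLevel_avg i f x y (idx_eq_of_le (Finset.mem_Icc.1 hi).2 h)

lemma measurableSet_cell (j : ℕ) (x : X) : MeasurableSet (G.cell j x) :=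
  G.measurableSet_fiber j (G.idx j x)

section Countable

variable [Countable ι]

lemma IsLevel.measurable {α : Type*} [MeasurableSpace α] {j : ℕ} {φ : X → α}
    (h : G.IsLevel j φ) : Measurable φ := by
  intro B _
  have : φ ⁻¹' B = ⋃ i ∈ G.idx j '' (φ ⁻¹' B), G.idx j ⁻¹' {i} := by
    ext x
    simp only [mem_preimage, mem_iUnion, mem_image, mem_singleton_iff, exists_prop]
    constructor
    · exact fun hx => ⟨_, ⟨x, hx, rfl⟩, rfl⟩
    · rintro ⟨i, ⟨y, hy, rfl⟩, hxy⟩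
      rwa [h x y hxy]
  rw [this]
  exact MeasurableSet.biUnion (to_countable _) fun i _ => G.measurableSet_fiber j i

lemma measurable_avg (j : ℕ) (f : X → ℝ≥0∞) : Measurable (G.avg μ j f) :=
  (isLevel_avg j f).measurable

lemma measurable_maxAvg (s J : ℕ) (f : X → ℝ≥0∞) : Measurable (G.maxAvg μ s J f) :=
  (isLevel_maxAvg f).measurable

lemma measurableSet_of_level {j : ℕ} {E : Set X}
    (hE : ∀ x y, G.idx j x = G.idx j y → x ∈ E → y ∈ E) : MeasurableSet E := by
  have h : G.IsLevel j (fun x => x ∈ E) :=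
    fun x y hxy => propext ⟨hE x y hxy, hE y x hxy.symm⟩
  exact measurableSet_setOfPred.2 h.measurable

/-- Integration over a union of cells of level `j` amounts to integration over each of them. -/
lemma setLIntegral_le_of_cell {j : ℕ} {E : Set X}
    (hE : ∀ x y, G.idx j x = G.idx j y → x ∈ E → y ∈ E) {u v : X → ℝ≥0∞} {μ ν : Measure X}
    (h : ∀ x ∈ E, ∫⁻ y in G.cell j x, u y ∂μ ≤ ∫⁻ y in G.cell j x, v y ∂ν) :
    ∫⁻ x in E, u x ∂μ ≤ ∫⁻ x in E, v x ∂ν := by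
  have hU : E = ⋃ i : G.idx j '' E, G.idx j ⁻¹' {(i : ι)} := by
    ext x
    simp only [mem_iUnion, mem_preimage, mem_singleton_iff, Subtype.exists, mem_image, exists_prop]
    constructor
    · exact fun hx => ⟨_, ⟨x, hx, rfl⟩, rfl⟩
    · rintro ⟨_, ⟨y, hy, rfl⟩, hxy⟩
      exact hE y x hxy.symm hy
  have hd : Pairwise (Function.onFun Disjoint
      fun i : G.idx j '' E => G.idx j ⁻¹' {(i : ι)}) := by
    intro a b hab
    refine Disjoint.preimage _ ?_
    simpa using fun h => hab (Subtype.ext h)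
  have hsum : ∀ (w : X → ℝ≥0∞) (ρ : Measure X), ∫⁻ x in E, w x ∂ρ =
      ∑' i : G.idx j '' E, ∫⁻ x in G.idx j ⁻¹' {(i : ι)}, w x ∂ρ := by
    intro w ρ
    conv_lhs => rw [hU]
    exact lintegral_iUnion (s := fun i : G.idx j '' E => G.idx j ⁻¹' {(i : ι)})
      (fun i => G.measurableSet_fiber j i) hd w
  rw [hsum, hsum]
  refine ENNReal.tsum_le_tsum ?_
  rintro ⟨_, x, hx, rfl⟩
  exact h x hx

/-- The averaging operator of level `j` is the conditional expectation on that level: it does not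
change integrals against weights that are constant on cells of level `j`. -/
lemma setLIntegral_mul_avg (hfin : ∀ j x, μ (G.cell j x) ≠ ⊤) {j : ℕ} {E : Set X}
    (hE : ∀ x y, G.idx j x = G.idx j y → x ∈ E → y ∈ E) {φ : X → ℝ≥0∞} (hφ : G.IsLevel j φ)
    {f : X → ℝ≥0∞} (hf : Measurable f) :
    ∫⁻ x in E, φ x * G.avg μ j f x ∂μ = ∫⁻ x in E, φ x * f x ∂μ := by
  have key : ∀ x, ∫⁻ y in G.cell j x, φ y * G.avg μ j f y ∂μ =
      ∫⁻ y in G.cell j x, φ y * f y ∂μ := by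
    intro x
    have h1 : ∫⁻ y in G.cell j x, φ y * G.avg μ j f y ∂μ =
        ∫⁻ y in G.cell j x, φ x * G.avg μ j f x ∂μ :=
      setLIntegral_congr_fun (measurableSet_cell j x) fun y hy => by
        rw [hφ y x hy, isLevel_avg j f y x hy]
    have h2 : ∫⁻ y in G.cell j x, φ y * f y ∂μ = ∫⁻ y in G.cell j x, φ x * f y ∂μ :=
      setLIntegral_congr_fun (measurableSet_cell j x) fun y hy => by rw [hφ y x hy]
    rw [h1, h2, lintegral_const_mul _ hf, setLIntegral_const, avg, mul_assoc]
    congr 1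
    rcases eq_or_ne (μ (G.cell j x)) 0 with h0 | h0
    · rw [h0, mul_zero, Measure.restrict_eq_zero.2 h0, lintegral_zero_measure]
    · rw [mul_comm, ← mul_assoc, ENNReal.mul_inv_cancel h0 (hfin j x), one_mul]
  exact le_antisymm (setLIntegral_le_of_cell hE fun x _ => (key x).le)
    (setLIntegral_le_of_cell hE fun x _ => (key x).ge)

/-- Optional stopping for averages: replacing `f` by its averages at a stopping time does not
change integrals over sets that are unions of stopped cells. -/
lemma setLIntegral_stopped (hfin : ∀ j x, μ (G.cell j x) ≠ ⊤) {t : X → ℕ} (ht : G.IsStopping t)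
    {E : Set X} (hE : ∀ x y, G.idx (t x) x = G.idx (t x) y → x ∈ E → y ∈ E)
    {f : X → ℝ≥0∞} (hf : Measurable f) :
    ∫⁻ x in E, G.avg μ (t x) f x ∂μ = ∫⁻ x in E, f x ∂μ := by
  have hU : E = ⋃ i, E ∩ t ⁻¹' {i} := by
    rw [← inter_iUnion, ← preimage_iUnion, iUnion_of_singleton, preimage_univ, inter_univ]
  have hlev : ∀ i x y, G.idx i x = G.idx i y → x ∈ E ∩ t ⁻¹' {i} → y ∈ E ∩ t ⁻¹' {i} := by
    rintro i x y hxy ⟨hx, rfl⟩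
    exact ⟨hE x y hxy hx, ht x y hxy⟩
  have hd : Pairwise (Function.onFun Disjoint fun i => E ∩ t ⁻¹' {i}) := by
    intro a b hab
    refine Disjoint.mono inter_subset_right inter_subset_right (Disjoint.preimage _ ?_)
    simpa using hab
  have hm : ∀ i, MeasurableSet (E ∩ t ⁻¹' {i}) := fun i => measurableSet_of_level (hlev i)
  rw [hU, lintegral_iUnion hm hd, lintegral_iUnion hm hd]
  refine tsum_congr fun i => ?_
  have h := setLIntegral_mul_avg hfin (hlev i) (φ := fun _ => 1) (fun _ _ _ => rfl) hf
  simp only [one_mul] at h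
  rw [← h]
  exact setLIntegral_congr_fun (hm i) fun x hx => by rw [show t x = i from hx.2]

lemma lintegral_stopped (hfin : ∀ j x, μ (G.cell j x) ≠ ⊤) {t : X → ℕ} (ht : G.IsStopping t)
    {f : X → ℝ≥0∞} (hf : Measurable f) :
    ∫⁻ x, G.avg μ (t x) f x ∂μ = ∫⁻ x, f x ∂μ := by
  simpa using setLIntegral_stopped hfin ht (E := univ) (fun _ _ _ _ => trivial) hf

end Countable

lemma IsStopping.isLevel_comp {α : Type*} {t : X → ℕ} (ht : G.IsStopping t) {J : ℕ}
    (hJ : ∀ x, t x ≤ J) {φ : ℕ → X → α} (hφ : ∀ j, G.IsLevel j (φ j)) :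
    G.IsLevel J (fun x => φ (t x) x) := by
  intro x y h
  have h' := idx_eq_of_le (hJ x) h
  simp only [ht x y h']
  exact hφ _ x y h'

/-! ### The first time an average is large -/

variable (G) in
/-- The first level `≤ J` at which the average of `f` exceeds `lam`, and `J` if there is none. -/
def hit (μ : Measure X) (f : X → ℝ≥0∞) (lam : ℝ≥0∞) (J : ℕ) (x : X) : ℕ :=
  sInf {i | lam < G.avg μ i f x ∨ i = J}

lemma hit_le (f : X → ℝ≥0∞) (lam : ℝ≥0∞) (J : ℕ) (x : X) : G.hit μ f lam J x ≤ J :=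
  Nat.sInf_le (Or.inr rfl)

lemma hit_spec (f : X → ℝ≥0∞) (lam : ℝ≥0∞) (J : ℕ) (x : X) :
    lam < G.avg μ (G.hit μ f lam J x) f x ∨ G.hit μ f lam J x = J :=
  Nat.sInf_mem (s := {i | lam < G.avg μ i f x ∨ i = J}) ⟨J, Or.inr rfl⟩

lemma avg_le_of_lt_hit {f : X → ℝ≥0∞} {lam : ℝ≥0∞} {J : ℕ} {x : X} {i : ℕ}
    (hi : i < G.hit μ f lam J x) : G.avg μ i f x ≤ lam := by
  by_contra h
  exact Nat.notMem_of_lt_sInf hi (Or.inl (not_le.1 h))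

lemma lt_avg_hit {f : X → ℝ≥0∞} {lam : ℝ≥0∞} {J : ℕ} {x : X}
    (h : lam < G.maxAvg μ 0 J f x) : lam < G.avg μ (G.hit μ f lam J x) f x := by
  obtain ⟨i, hi, hlt⟩ := Finset.lt_sup_iff.1 h
  rcases hit_spec (G := G) (μ := μ) f lam J x with h' | h'
  · exact h'
  · have h1 : G.hit μ f lam J x ≤ i := Nat.sInf_le (Or.inl hlt)
    have h2 := (Finset.mem_Icc.1 hi).2
    rw [show G.hit μ f lam J x = i by omega]
    exact hlt

lemma isStopping_hit (f : X → ℝ≥0∞) (lam : ℝ≥0∞) (J : ℕ) : G.IsStopping (G.hit μ f lam J) := by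
  intro x y h
  have havg : ∀ i ≤ G.hit μ f lam J x, G.avg μ i f x = G.avg μ i f y := fun i hi =>
    isLevel_avg i f x y (idx_eq_of_le hi h)
  refine le_antisymm (Nat.sInf_le ?_) (not_lt.1 fun hlt => ?_)
  · simp only [mem_ofPred_eq, ← havg _ le_rfl]
    exact hit_spec f lam J x
  · rcases hit_spec (G := G) (μ := μ) f lam J y with h' | h'
    · rw [← havg _ hlt.le] at h'
      exact absurd (avg_le_of_lt_hit hlt) (not_le.2 h')
    · have := hit_le (G := G) (μ := μ) f lam J x
      omega

/-! ### Maximal inequalities -/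

lemma avg_mono {j : ℕ} {f g : X → ℝ≥0∞} {x : X} (h : ∀ y, f y ≤ g y) :
    G.avg μ j f x ≤ G.avg μ j g x :=
  mul_le_mul_right (lintegral_mono h) _

lemma avg_const_le (j : ℕ) (c : ℝ≥0∞) (x : X) : G.avg μ j (fun _ => c) x ≤ c := by
  rw [avg, setLIntegral_const, mul_comm, mul_assoc]
  exact (mul_le_mul_right (ENNReal.mul_inv_le_one _) c).trans_eq (mul_one c)

/-- Minkowski's inequality for averages. -/
lemma tsum_avg_rpow_le {f : ℕ → X → ℝ≥0∞} (hf : ∀ k, Measurable (f k)) {r : ℝ} (hr : 1 < r)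
    (j : ℕ) (x : X) :
    ∑' k, G.avg μ j (f k) x ^ r ≤ G.avg μ j (fun y => ellNorm r fun k => f k y) x ^ r := by
  have h := tsum_lintegral_rpow_le (μ := (μ (G.cell j x))⁻¹ • μ.restrict (G.cell j x)) hf hr
  simpa only [lintegral_smul_measure, smul_eq_mul, avg] using h

section Maximal

variable [Countable ι]

lemma mul_meas_lt_maxAvg_le (hfin : ∀ j x, μ (G.cell j x) ≠ ⊤) {f : X → ℝ≥0∞}
    (hf : Measurable f) (J : ℕ) (lam : ℝ≥0∞) :
    lam * μ {x | lam < G.maxAvg μ 0 J f x} ≤ ∫⁻ x, f x ∂μ := by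
  calc lam * μ {x | lam < G.maxAvg μ 0 J f x}
      = ∫⁻ _ in {x | lam < G.maxAvg μ 0 J f x}, lam ∂μ := by rw [setLIntegral_const]
    _ ≤ ∫⁻ x in {x | lam < G.maxAvg μ 0 J f x}, G.avg μ (G.hit μ f lam J x) f x ∂μ :=
        setLIntegral_mono' (measurableSet_lt measurable_const (measurable_maxAvg 0 J f))
          fun x hx => (lt_avg_hit hx).le
    _ ≤ ∫⁻ x, G.avg μ (G.hit μ f lam J x) f x ∂μ := setLIntegral_le_lintegral _ _
    _ = _ := lintegral_stopped hfin (isStopping_hit f lam J) hf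

/-- The constant in Doob's maximal inequality in `L^b`. -/
def doobConst (b : ℝ) : ℝ≥0∞ := ENNReal.ofReal (b / (b - 1)) * 2 ^ b

/-- Doob's maximal inequality. -/
lemma lintegral_maxAvg_rpow_le [SFinite μ] (hfin : ∀ j x, μ (G.cell j x) ≠ ⊤) {f : X → ℝ≥0∞}
    (hf : Measurable f) (J : ℕ) {b : ℝ} (hb : 1 < b) :
    ∫⁻ x, G.maxAvg μ 0 J f x ^ b ∂μ ≤ doobConst b * ∫⁻ x, f x ^ b ∂μ := by
  have hb0 : 0 < b := by linarith
  have hb1 : 0 < b - 1 := by linarith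
  -- only the part of `f` above `s / 2` contributes to the set where the maximal function is `> s`
  have hweak : ∀ s : ℝ, 0 < s → μ {x | ENNReal.ofReal s < G.maxAvg μ 0 J f x} ≤
      ENNReal.ofReal (2 / s) * ∫⁻ x in {x | ENNReal.ofReal s < 2 * f x}, f x ∂μ := by
    intro s hs
    set h : X → ℝ≥0∞ := {x | ENNReal.ofReal s < 2 * f x}.indicator f with hh
    have hset : MeasurableSet {x | ENNReal.ofReal s < 2 * f x} :=
      measurableSet_lt measurable_const (hf.const_mul 2)
    have hhm : Measurable h := hf.indicator hset
    have hfh : ∀ x, f x ≤ h x + ENNReal.ofReal (s / 2) := by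
      intro x
      by_cases hx : ENNReal.ofReal s < 2 * f x
      · simp [hh, hx]
      · rw [not_lt] at hx
        refine le_trans ?_ le_add_self
        rw [ENNReal.ofReal_div_of_pos two_pos, ENNReal.le_div_iff_mul_le (by simp) (by simp)]
        simpa [mul_comm] using hx
    have hsub : {x | ENNReal.ofReal s < G.maxAvg μ 0 J f x} ⊆
        {x | ENNReal.ofReal (s / 2) < G.maxAvg μ 0 J h x} := by
      intro x (hx : ENNReal.ofReal s < G.maxAvg μ 0 J f x)
      obtain ⟨i, hi, hlt⟩ := Finset.lt_sup_iff.1 hx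
      change ENNReal.ofReal (s / 2) < G.maxAvg μ 0 J h x
      refine Finset.lt_sup_iff.2 ⟨i, hi, ?_⟩
      have h1 : G.avg μ i f x ≤ G.avg μ i h x + ENNReal.ofReal (s / 2) := by
        refine (avg_mono hfh).trans ?_
        rw [avg, lintegral_add_left hhm, mul_add]
        exact add_le_add le_rfl (avg_const_le i _ x)
      have h2 : ENNReal.ofReal (s / 2) + ENNReal.ofReal (s / 2) <
          G.avg μ i h x + ENNReal.ofReal (s / 2) := by
        rw [← ENNReal.ofReal_add (by positivity) (by positivity), add_halves]
        exact hlt.trans_le h1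
      exact lt_of_add_lt_add_right h2
    have hw := mul_meas_lt_maxAvg_le hfin hhm J (ENNReal.ofReal (s / 2))
    rw [lintegral_indicator hset] at hw
    have hs2 : ENNReal.ofReal (2 / s) * ENNReal.ofReal (s / 2) = 1 := by
      rw [← ENNReal.ofReal_mul (by positivity)]
      simp [hs.ne']
    calc μ {x | ENNReal.ofReal s < G.maxAvg μ 0 J f x}
        ≤ μ {x | ENNReal.ofReal (s / 2) < G.maxAvg μ 0 J h x} := measure_mono hsub
      _ = ENNReal.ofReal (2 / s) * (ENNReal.ofReal (s / 2) *
            μ {x | ENNReal.ofReal (s / 2) < G.maxAvg μ 0 J h x}) := by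
          rw [← mul_assoc, hs2, one_mul]
      _ ≤ _ := mul_le_mul_right hw _
  rw [lintegral_rpow_eq_lintegral_meas (measurable_maxAvg 0 J f) hb0]
  have h2f : Measurable fun x => 2 * f x := hf.const_mul 2
  calc ∫⁻ s in Ioi (0 : ℝ), ENNReal.ofReal (b * s ^ (b - 1)) *
        μ {x | ENNReal.ofReal s < G.maxAvg μ 0 J f x}
      ≤ ∫⁻ s in Ioi (0 : ℝ), ENNReal.ofReal (2 * (b / (b - 1))) *
          (ENNReal.ofReal ((b - 1) * s ^ (b - 1 - 1)) *
            ∫⁻ x in {x | ENNReal.ofReal s < 2 * f x}, f x ∂μ) := by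
        refine setLIntegral_mono' measurableSet_Ioi fun s hs => ?_
        have hs : 0 < s := hs
        refine (mul_le_mul_right (hweak s hs) _).trans_eq ?_
        rw [← mul_assoc, ← mul_assoc, ← ENNReal.ofReal_mul (by positivity),
          ← ENNReal.ofReal_mul (by positivity)]
        congr 2
        rw [Real.rpow_sub_one hs.ne' (b - 1)]
        field_simp
    _ = ENNReal.ofReal (2 * (b / (b - 1))) * ∫⁻ x, f x * (2 * f x) ^ (b - 1) ∂μ := by
        rw [lintegral_const_mul' _ _ ENNReal.ofReal_ne_top,
          lintegral_weight_mul_meas_lt (ν := μ) h2f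
            (w := fun s => ENNReal.ofReal ((b - 1) * s ^ (b - 1 - 1))) (by fun_prop) hf]
        simp_rw [lintegral_indicator_rpow_weight hb1]
    _ = doobConst b * ∫⁻ x, f x ^ b ∂μ := by
        have : ∀ x, f x * (2 * f x) ^ (b - 1) = 2 ^ (b - 1) * f x ^ b := by
          intro x
          rw [ENNReal.mul_rpow_of_nonneg _ _ hb1.le, mul_left_comm]
          congr 1
          nth_rewrite 1 [← ENNReal.rpow_one (f x)]
          rw [← ENNReal.rpow_add_of_nonneg _ _ zero_le_one hb1.le]
          congr 1; ring
        simp_rw [this]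
        rw [lintegral_const_mul _ (hf.pow_const b), ← mul_assoc, doobConst,
          ENNReal.ofReal_mul two_pos.le, ENNReal.ofReal_ofNat,
          mul_comm 2 (ENNReal.ofReal _), mul_assoc (ENNReal.ofReal _)]
        congr 2
        nth_rewrite 1 [← ENNReal.rpow_one 2]
        rw [← ENNReal.rpow_add_of_nonneg _ _ zero_le_one hb1.le]
        congr 1; ring

end Maximal

end Grid

namespace Grid

variable {X ι : Type*} [MeasurableSpace X] {G : Grid X ι} {μ ν : Measure X}

lemma avg_succ_le {D : ℝ≥0∞} (hD1 : 1 ≤ D) (hDt : D ≠ ⊤)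
    (hD : ∀ j x, μ (G.cell j x) ≤ D * μ (G.cell (j + 1) x)) (j : ℕ) (f : X → ℝ≥0∞) (x : X) :
    G.avg μ (j + 1) f x ≤ D * G.avg μ j f x := by
  have hD0 : D ≠ 0 := (zero_lt_one.trans_le hD1).ne'
  have hsub : G.cell (j + 1) x ⊆ G.cell j x := fun y hy => G.nested j y x hy
  rw [avg, avg, ← mul_assoc]
  rcases eq_or_ne (μ (G.cell (j + 1) x)) 0 with h0 | h0
  · rw [Measure.restrict_eq_zero.2 h0, lintegral_zero_measure, mul_zero]
    exact zero_le
  refine mul_le_mul' ?_ (lintegral_mono_set hsub)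
  calc (μ (G.cell (j + 1) x))⁻¹ = D * (D * μ (G.cell (j + 1) x))⁻¹ := by
        rw [ENNReal.mul_inv (Or.inl hD0) (Or.inl hDt), ← mul_assoc,
          ENNReal.mul_inv_cancel hD0 hDt, one_mul]
    _ ≤ _ := mul_le_mul_right (ENNReal.inv_le_inv.2 (hD j x)) _

variable [Countable ι]

/-- The constant in the vector-valued weak-type inequality for a `D`-regular grid. -/
def weakConst (r : ℝ) (D : ℝ≥0∞) : ℝ≥0∞ := 1 + doobConst r * D ^ (r - 1)

/-- The weak-type `(1,1)` inequality for the `ℓ^r`-valued maximal function, at heights above all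
averages of level `0`. Stopping each `f k` when the average of `|f|_r` exceeds `lam` gives a
function bounded by `D * lam` with the same maximal function off the stopped set. -/
lemma mul_meas_lt_tsum_maxAvg_le [SFinite μ] (hfin : ∀ j x, μ (G.cell j x) ≠ ⊤) {D : ℝ≥0∞}
    (hD1 : 1 ≤ D) (hDt : D ≠ ⊤) (hD : ∀ j x, μ (G.cell j x) ≤ D * μ (G.cell (j + 1) x))
    {f : ℕ → X → ℝ≥0∞} (hf : ∀ k, Measurable (f k)) {r : ℝ} (hr : 1 < r) (J : ℕ) {lam : ℝ≥0∞}
    (hl0 : lam ≠ 0) (hlt : lam ≠ ⊤)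
    (h0 : ∀ x, G.avg μ 0 (fun y => ellNorm r fun k => f k y) x ≤ lam) :
    lam * μ {x | lam ^ r < ∑' k, G.maxAvg μ 0 J (f k) x ^ r} ≤
      weakConst r D * ∫⁻ x, ellNorm r (fun k => f k x) ∂μ := by
  have hr0 : 0 < r := by linarith
  set F : X → ℝ≥0∞ := fun y => ellNorm r fun k => f k y with hF
  have hFm : Measurable F := measurable_ellNorm hf r
  set t := G.hit μ F lam J with ht
  have hts : G.IsStopping t := isStopping_hit F lam J
  set g : ℕ → X → ℝ≥0∞ := fun k x => G.avg μ (t x) (f k) x with hg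
  have hgm : ∀ k, Measurable (g k) := fun k =>
    (hts.isLevel_comp (hit_le F lam J) (φ := fun j => G.avg μ j (f k))
      fun j => isLevel_avg j _).measurable
  set Ω := {x | lam < G.maxAvg μ 0 J F x} with hΩ
  have hstopF : ∀ x, G.avg μ (t x) F x ≤ D * lam := by
    intro x
    rcases h : t x with _ | i
    · exact (h0 x).trans (le_mul_of_one_le_left zero_le hD1)
    · exact (avg_succ_le hD1 hDt hD i F x).trans
        (mul_le_mul_right (avg_le_of_lt_hit (by rw [← ht, h]; exact Nat.lt_succ_self i)) _)
  -- off `Ω` nothing is stopped inside the cells around `x`, so `f k` and `g k` have equal averages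
  have heq : ∀ x, x ∉ Ω → ∀ k, G.maxAvg μ 0 J (f k) x = G.maxAvg μ 0 J (g k) x := by
    intro x hx k
    refine Finset.sup_congr rfl fun j hj => ?_
    have hjJ := (Finset.mem_Icc.1 hj).2
    have hle : ∀ y ∈ G.cell j x, j ≤ t y := by
      intro y hy
      by_contra hlt'
      rw [not_le] at hlt'
      apply hx
      rcases hit_spec (G := G) (μ := μ) F lam J y with h' | h'
      · change lam < G.maxAvg μ 0 J F x
        refine Finset.lt_sup_iff.2 ⟨t y, Finset.mem_Icc.2 ⟨Nat.zero_le _, hlt'.le.trans hjJ⟩, ?_⟩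
        rwa [← isLevel_avg (t y) F y x (idx_eq_of_le hlt'.le hy)]
      · rw [← ht] at h'
        omega
    rw [avg, avg]
    congr 1
    refine (setLIntegral_stopped hfin hts (fun y z hyz hy => ?_) (hf k)).symm
    exact (idx_eq_of_le (hle y hy) hyz).symm.trans hy
  have hsub : {x | lam ^ r < ∑' k, G.maxAvg μ 0 J (f k) x ^ r} ⊆
      Ω ∪ {x | lam ^ r ≤ ∑' k, G.maxAvg μ 0 J (g k) x ^ r} := by
    intro x (hx : lam ^ r < ∑' k, G.maxAvg μ 0 J (f k) x ^ r)
    by_cases hxΩ : x ∈ Ω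
    · exact Or.inl hxΩ
    · refine Or.inr ?_
      change lam ^ r ≤ ∑' k, G.maxAvg μ 0 J (g k) x ^ r
      simp_rw [← heq x hxΩ]
      exact hx.le
  have hgood : lam ^ r * μ {x | lam ^ r ≤ ∑' k, G.maxAvg μ 0 J (g k) x ^ r} ≤
      doobConst r * ((D * lam) ^ (r - 1) * ∫⁻ x, F x ∂μ) := by
    have hm : ∀ k, Measurable fun x => G.maxAvg μ 0 J (g k) x ^ r := fun k =>
      (measurable_maxAvg 0 J (g k)).pow_const r
    calc lam ^ r * μ {x | lam ^ r ≤ ∑' k, G.maxAvg μ 0 J (g k) x ^ r}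
        ≤ ∫⁻ x, ∑' k, G.maxAvg μ 0 J (g k) x ^ r ∂μ :=
          mul_meas_ge_le_lintegral (Measurable.tsum hm) _
      _ = ∑' k, ∫⁻ x, G.maxAvg μ 0 J (g k) x ^ r ∂μ :=
          lintegral_tsum fun k => (hm k).aemeasurable
      _ ≤ ∑' k, doobConst r * ∫⁻ x, g k x ^ r ∂μ :=
          ENNReal.tsum_le_tsum fun k => lintegral_maxAvg_rpow_le hfin (hgm k) J hr
      _ = doobConst r * ∫⁻ x, ∑' k, g k x ^ r ∂μ := by
          rw [ENNReal.tsum_mul_left,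
            lintegral_tsum fun k => ((hgm k).pow_const r).aemeasurable]
      _ ≤ doobConst r * ∫⁻ x, (D * lam) ^ (r - 1) * G.avg μ (t x) F x ∂μ := by
          refine mul_le_mul_right (lintegral_mono fun x => ?_) _
          refine (tsum_avg_rpow_le hf hr (t x) x).trans ?_
          change G.avg μ (t x) F x ^ r ≤ _
          calc G.avg μ (t x) F x ^ r = G.avg μ (t x) F x ^ (r - 1) * G.avg μ (t x) F x := by
                nth_rewrite 3 [← ENNReal.rpow_one (G.avg μ (t x) F x)]
                rw [← ENNReal.rpow_add_of_nonneg _ _ (by linarith) zero_le_one]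
                congr 1; ring
            _ ≤ _ := mul_le_mul_left
                (ENNReal.rpow_le_rpow (hstopF x) (by linarith)) _
      _ = _ := by
          rw [lintegral_const_mul', lintegral_stopped hfin hts hFm]
          exact ENNReal.rpow_ne_top_of_nonneg (by linarith) (ENNReal.mul_ne_top hDt hlt)
  have hgood' : lam * μ {x | lam ^ r ≤ ∑' k, G.maxAvg μ 0 J (g k) x ^ r} ≤
      doobConst r * D ^ (r - 1) * ∫⁻ x, F x ∂μ := by
    have hne0 : lam ^ (r - 1) ≠ 0 := by simp [ENNReal.rpow_eq_zero_iff, hl0, hlt]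
    have hnet : lam ^ (r - 1) ≠ ⊤ := ENNReal.rpow_ne_top_of_nonneg (by linarith) hlt
    rw [← ENNReal.mul_le_mul_iff_right hne0 hnet]
    refine le_of_eq_of_le ?_ (hgood.trans_eq ?_)
    · rw [← mul_assoc]
      congr 1
      nth_rewrite 2 [← ENNReal.rpow_one lam]
      rw [← ENNReal.rpow_add_of_nonneg _ _ (by linarith) zero_le_one]
      congr 1; ring
    · rw [ENNReal.mul_rpow_of_nonneg _ _ (by linarith)]
      ring
  calc lam * μ {x | lam ^ r < ∑' k, G.maxAvg μ 0 J (f k) x ^ r}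
      ≤ lam * (μ Ω + μ {x | lam ^ r ≤ ∑' k, G.maxAvg μ 0 J (g k) x ^ r}) :=
        mul_le_mul_right ((measure_mono hsub).trans (measure_union_le _ _)) _
    _ ≤ ∫⁻ x, F x ∂μ + doobConst r * D ^ (r - 1) * ∫⁻ x, F x ∂μ := by
        rw [mul_add]
        exact add_le_add (mul_meas_lt_maxAvg_le hfin hFm J lam) hgood'
    _ = _ := by rw [weakConst, add_mul, one_mul]

/-- The weak-type inequality localized to a cell, at height `A` times the average. -/
lemma meas_cell_inter_le [SFinite μ] (hfin : ∀ j x, μ (G.cell j x) ≠ ⊤) {D : ℝ≥0∞}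
    (hD1 : 1 ≤ D) (hDt : D ≠ ⊤) (hD : ∀ j x, μ (G.cell j x) ≤ D * μ (G.cell (j + 1) x))
    {f : ℕ → X → ℝ≥0∞} (hf : ∀ k, Measurable (f k)) {r : ℝ} (hr : 1 < r) {j J : ℕ} (hjJ : j ≤ J)
    {A : ℝ≥0∞} (hA1 : 1 ≤ A) (hAt : A ≠ ⊤) (x : X) (hx0 : μ (G.cell j x) ≠ 0) :
    A * μ (G.cell j x ∩ {y | (A * G.avg μ j (fun y => ellNorm r fun k => f k y) x) ^ r <
      ∑' k, G.maxAvg μ j J (f k) y ^ r}) ≤ weakConst r D * μ (G.cell j x) := by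
  have hr0 : 0 < r := by linarith
  have hA0 : A ≠ 0 := (zero_lt_one.trans_le hA1).ne'
  set F : X → ℝ≥0∞ := fun y => ellNorm r fun k => f k y with hF
  set a := G.avg μ j F x with ha
  rcases eq_or_ne a ⊤ with hat | hat
  · have : ∀ b : ℝ≥0∞, ¬ (A * ⊤) ^ r < b := by
      intro b
      rw [ENNReal.mul_top hA0, ENNReal.top_rpow_of_pos hr0]
      exact not_top_lt
    simp [hat, this]
  have hint : ∫⁻ y in G.cell j x, F y ∂μ = a * μ (G.cell j x) := by
    rw [ha, avg, mul_right_comm, ENNReal.inv_mul_cancel hx0 (hfin j x), one_mul]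
  rcases eq_or_ne a 0 with ha0 | ha0
  · have hz : ∀ y ∈ G.cell j x, ∑' k, G.maxAvg μ j J (f k) y ^ r = 0 := by
      intro y hy
      rw [ENNReal.tsum_eq_zero]
      intro k
      have : G.maxAvg μ j J (f k) y = 0 := by
        rw [← bot_eq_zero, maxAvg, Finset.sup_eq_bot_iff]
        intro i hi
        have hsub : G.cell i y ⊆ G.cell j x := fun z hz =>
          (idx_eq_of_le (Finset.mem_Icc.1 hi).1 hz).trans hy
        have : ∫⁻ z in G.cell i y, f k z ∂μ = 0 := by
          refine le_antisymm ?_ zero_le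
          calc ∫⁻ z in G.cell i y, f k z ∂μ ≤ ∫⁻ z in G.cell j x, F z ∂μ :=
                (lintegral_mono_set hsub).trans
                  (lintegral_mono fun z => le_ellNorm hr0 (fun k => f k z) k)
            _ = 0 := by rw [hint, ha0, zero_mul]
        rw [avg, this, mul_zero]; rfl
      rw [this, ENNReal.zero_rpow_of_pos hr0]
    have : G.cell j x ∩ {y | (A * a) ^ r < ∑' k, G.maxAvg μ j J (f k) y ^ r} = ∅ := by
      refine eq_empty_of_forall_notMem fun y hy => ?_
      have h2 : (A * a) ^ r < ∑' k, G.maxAvg μ j J (f k) y ^ r := hy.2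
      rw [hz y hy.1] at h2
      exact not_lt_zero h2
    rw [this, measure_empty, mul_zero]
    exact zero_le
  set Q := G.cell j x with hQ
  have hQm : MeasurableSet Q := measurableSet_cell j x
  set f' : ℕ → X → ℝ≥0∞ := fun k => Q.indicator (f k) with hf'
  have hf'm : ∀ k, Measurable (f' k) := fun k => (hf k).indicator hQm
  have hF' : (fun y => ellNorm r fun k => f' k y) = Q.indicator F := by
    funext y
    by_cases hy : y ∈ Q
    · simp [hf', hF, hy]
    · simp [hf', hy, ellNorm, ENNReal.zero_rpow_of_pos hr0, hr0]
  have hAa0 : A * a ≠ 0 := mul_ne_zero hA0 ha0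
  have hAat : A * a ≠ ⊤ := ENNReal.mul_ne_top hAt hat
  have hw := mul_meas_lt_tsum_maxAvg_le (G := G.shift j) (μ := μ) (fun i y => hfin (j + i) y)
    hD1 hDt (fun i y => hD (j + i) y) hf'm hr (J - j) hAa0 hAat (by
      intro y
      rw [hF']
      change G.avg μ j (Q.indicator F) y ≤ A * a
      by_cases hy : y ∈ Q
      · rw [isLevel_avg j _ y x hy, avg, ← hQ, setLIntegral_indicator hQm, inter_self,
          ← avg, ← ha]
        exact le_mul_of_one_le_left zero_le hA1
      · have hdisj : Q ∩ G.cell j y = ∅ := by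
          refine eq_empty_of_forall_notMem fun z hz => hy ?_
          have h1 : G.idx j z = G.idx j x := hz.1
          have h2 : G.idx j z = G.idx j y := hz.2
          exact h2.symm.trans h1
        rw [avg, setLIntegral_indicator hQm, hdisj]
        simp)
  rw [hF', lintegral_indicator hQm, hint] at hw
  have hsub : Q ∩ {y | (A * a) ^ r < ∑' k, G.maxAvg μ j J (f k) y ^ r} ⊆
      {y | (A * a) ^ r < ∑' k, (G.shift j).maxAvg μ 0 (J - j) (f' k) y ^ r} := by
    rintro y ⟨hyQ, hy⟩
    change (A * a) ^ r < ∑' k, G.maxAvg μ j J (f k) y ^ r at hy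
    refine lt_of_lt_of_le hy (ENNReal.tsum_le_tsum fun k => ENNReal.rpow_le_rpow ?_ hr0.le)
    refine Finset.sup_le fun i hi => ?_
    obtain ⟨hi1, hi2⟩ := Finset.mem_Icc.1 hi
    have hsub : G.cell i y ⊆ Q := fun z hz => (idx_eq_of_le hi1 hz).trans hyQ
    have h1 : G.avg μ i (f k) y = (G.shift j).avg μ (i - j) (f' k) y := by
      change _ = G.avg μ (j + (i - j)) (f' k) y
      rw [Nat.add_sub_cancel' hi1, avg, avg, setLIntegral_indicator hQm,
        inter_eq_right.2 hsub]
    rw [h1]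
    exact Finset.le_sup (f := fun i => (G.shift j).avg μ i (f' k) y)
      (Finset.mem_Icc.2 ⟨Nat.zero_le _, by omega⟩)
  rw [← ENNReal.mul_le_mul_iff_right ha0 hat]
  calc a * (A * μ (Q ∩ {y | (A * a) ^ r < ∑' k, G.maxAvg μ j J (f k) y ^ r}))
      = A * a * μ (Q ∩ {y | (A * a) ^ r < ∑' k, G.maxAvg μ j J (f k) y ^ r}) := by ring
    _ ≤ weakConst r D * (a * μ Q) := (mul_le_mul_right (measure_mono hsub) _).trans hw
    _ = _ := by ring

end Grid

namespace Grid

variable {X ι : Type*} [MeasurableSpace X] (G : Grid X ι) {μ ν : Measure X}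

/-! ### Sparse domination -/

/-- The last selected level `≤ j` at the point `x`. Level `0` is selected, and after `s` the next
selected level is the first one at which the `ℓ^r` norm of the maximal functions over the levels
from `s` on exceeds `A` times the average of `|f|_r` at level `s`. -/
def lastSel (μ : Measure X) (f : ℕ → X → ℝ≥0∞) (r : ℝ) (A : ℝ≥0∞) : ℕ → X → ℕ
  | 0, _ => 0
  | j + 1, x =>
    open scoped Classical in
    if (A * G.avg μ (lastSel μ f r A j x) (fun y => ellNorm r fun k => f k y) x) ^ r <
        ∑' k, G.maxAvg μ (lastSel μ f r A j x) (j + 1) (f k) x ^ r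
    then j + 1 else lastSel μ f r A j x

/-- The union of the selected cells of level `j`. -/
def sel (μ : Measure X) (f : ℕ → X → ℝ≥0∞) (r : ℝ) (A : ℝ≥0∞) (j : ℕ) : Set X :=
  {x | G.lastSel μ f r A j x = j}

variable {G} {f : ℕ → X → ℝ≥0∞} {r : ℝ} {A : ℝ≥0∞}

lemma lastSel_le (j : ℕ) (x : X) : G.lastSel μ f r A j x ≤ j := by
  induction j with
  | zero => exact le_rfl
  | succ j ih =>
    rw [lastSel]
    split_ifs
    · exact le_rfl
    · omega

lemma isLevel_lastSel (j : ℕ) : G.IsLevel j (G.lastSel μ f r A j) := by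
  induction j with
  | zero => exact fun _ _ _ => rfl
  | succ j ih =>
    intro x y h
    have h1 := ih x y (G.nested j x y h)
    have h2 := lastSel_le (G := G) (μ := μ) (f := f) (r := r) (A := A) j y
    have h3 : ∀ g, G.avg μ (G.lastSel μ f r A j y) g x = G.avg μ (G.lastSel μ f r A j y) g y :=
      fun g => isLevel_avg _ g x y (idx_eq_of_le (by omega) h)
    have h4 : ∀ s g, G.maxAvg μ s (j + 1) g x = G.maxAvg μ s (j + 1) g y :=
      fun s g => isLevel_maxAvg g x y h
    simp only [lastSel, h1, h3, h4]

lemma mem_sel_of_idx_eq {j : ℕ} {x y : X} (h : G.idx j x = G.idx j y)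
    (hx : x ∈ G.sel μ f r A j) : y ∈ G.sel μ f r A j := by
  change G.lastSel μ f r A j y = j
  rw [← isLevel_lastSel j x y h]
  exact hx

/-- Once level `j` is selected, a later selection requires the stopping condition to have been met
relative to level `j`. -/
lemma exists_of_lastSel_ne {j j' : ℕ} (hjj : j ≤ j') {x : X} (hx : G.lastSel μ f r A j x = j)
    (hx' : G.lastSel μ f r A j' x ≠ j) : ∃ i, j ≤ i ∧ i ≤ j' ∧
      (A * G.avg μ j (fun y => ellNorm r fun k => f k y) x) ^ r <
        ∑' k, G.maxAvg μ j i (f k) x ^ r := by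
  induction j', hjj using Nat.le_induction with
  | base => exact absurd hx hx'
  | succ j' hj ih =>
    by_cases h : G.lastSel μ f r A j' x = j
    · rw [lastSel] at hx'
      split_ifs at hx' with hc
      · rw [h] at hc
        exact ⟨j' + 1, by omega, le_rfl, hc⟩
      · exact absurd h hx'
    · obtain ⟨i, h1, h2, h3⟩ := ih h
      exact ⟨i, h1, by omega, h3⟩

lemma lastSel_mem_sel (j : ℕ) (x : X) : x ∈ G.sel μ f r A (G.lastSel μ f r A j x) := by
  induction j with
  | zero => exact rfl
  | succ j ih =>
    by_cases hc : (A * G.avg μ (G.lastSel μ f r A j x) (fun y => ellNorm r fun k => f k y) x) ^ r <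
        ∑' k, G.maxAvg μ (G.lastSel μ f r A j x) (j + 1) (f k) x ^ r
    · have h : G.lastSel μ f r A (j + 1) x = j + 1 := by rw [lastSel, if_pos hc]
      rw [h]
      exact h
    · rwa [lastSel, if_neg hc]

/-- Pointwise domination of the `ℓ^r`-valued maximal function by the selected averages. -/
lemma tsum_maxAvg_le_sum_sel (hf : ∀ k, Measurable (f k)) (hr : 1 < r) (hA : 1 ≤ A) (J : ℕ)
    (x : X) : ∑' k, G.maxAvg μ 0 J (f k) x ^ r ≤
      ∑ j ∈ Finset.range (J + 1), (G.sel μ f r A j).indicator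
        (fun x => (A * G.avg μ j (fun y => ellNorm r fun k => f k y) x) ^ r) x := by
  have hr0 : 0 < r := by linarith
  set F : X → ℝ≥0∞ := fun y => ellNorm r fun k => f k y with hF
  set u : ℕ → ℝ≥0∞ := fun j => (G.sel μ f r A j).indicator (fun x => (A * G.avg μ j F x) ^ r) x
    with hu
  set L : ℕ → ℕ := fun J => G.lastSel μ f r A J x with hL
  have huL : ∀ J, u (L J) = (A * G.avg μ (L J) F x) ^ r := fun J =>
    indicator_of_mem (lastSel_mem_sel J x) _
  -- the levels from the last selected one on have not met the stopping condition
  have hlast : ∀ J, ∑' k, G.maxAvg μ (L J) J (f k) x ^ r ≤ u (L J) := by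
    have hsame : ∀ j, u j = (A * G.avg μ j F x) ^ r →
        ∑' k, G.maxAvg μ j j (f k) x ^ r ≤ u j := by
      intro j hj
      simp only [maxAvg, Finset.Icc_self, Finset.sup_singleton]
      rw [hj]
      exact (tsum_avg_rpow_le hf hr j x).trans
        (ENNReal.rpow_le_rpow (le_mul_of_one_le_left zero_le hA) hr0.le)
    intro J
    cases J with
    | zero => exact hsame 0 (huL 0)
    | succ J =>
      by_cases hc : (A * G.avg μ (L J) F x) ^ r < ∑' k, G.maxAvg μ (L J) (J + 1) (f k) x ^ r
      · have h : L (J + 1) = J + 1 := by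
          change G.lastSel μ f r A (J + 1) x = J + 1
          rw [lastSel, if_pos hc]
        have h' := huL (J + 1)
        rw [h] at h' ⊢
        exact hsame _ h'
      · have h : L (J + 1) = L J := by
          change G.lastSel μ f r A (J + 1) x = _
          rw [lastSel, if_neg hc]
        rw [h, huL]
        exact not_lt.1 hc
  have hstep : ∀ J, ∑' k, ((Finset.range (L J)).sup fun i => G.avg μ i (f k) x) ^ r ≤
      ∑ j ∈ Finset.range (L J), u j →
        ∑' k, ((Finset.range (J + 1)).sup fun i => G.avg μ i (f k) x) ^ r ≤
          ∑ j ∈ Finset.range (J + 1), u j := by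
    intro J hJ
    have hLJ : L J ≤ J := lastSel_le J x
    calc ∑' k, ((Finset.range (J + 1)).sup fun i => G.avg μ i (f k) x) ^ r
        ≤ ∑' k, (((Finset.range (L J)).sup fun i => G.avg μ i (f k) x) ^ r +
            G.maxAvg μ (L J) J (f k) x ^ r) := by
          refine ENNReal.tsum_le_tsum fun k => ?_
          have hunion : Finset.range (J + 1) = Finset.range (L J) ∪ Finset.Icc (L J) J := by
            ext i
            simp only [Finset.mem_range, Finset.mem_union, Finset.mem_Icc]
            omega
          rw [hunion, Finset.sup_union, ← maxAvg]
          rcases le_total ((Finset.range (L J)).sup fun i => G.avg μ i (f k) x)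
            (G.maxAvg μ (L J) J (f k) x) with h | h
          · rw [sup_eq_right.2 h]; exact le_add_self
          · rw [sup_eq_left.2 h]; exact le_self_add
      _ ≤ ∑ j ∈ Finset.range (L J), u j + u (L J) := by
          rw [ENNReal.tsum_add]
          exact add_le_add hJ (hlast J)
      _ ≤ ∑ j ∈ Finset.range (J + 1), u j := by
          rw [← Finset.sum_range_succ]
          exact Finset.sum_le_sum_of_subset (Finset.range_mono (by omega))
  have hprev : ∀ J, ∑' k, ((Finset.range (L J)).sup fun i => G.avg μ i (f k) x) ^ r ≤
      ∑ j ∈ Finset.range (L J), u j := by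
    intro J
    induction J with
    | zero =>
      have : L 0 = 0 := rfl
      simp [this, ENNReal.zero_rpow_of_pos hr0]
    | succ J ih =>
      by_cases hc : (A * G.avg μ (L J) F x) ^ r < ∑' k, G.maxAvg μ (L J) (J + 1) (f k) x ^ r
      · have h : L (J + 1) = J + 1 := by
          change G.lastSel μ f r A (J + 1) x = J + 1
          rw [lastSel, if_pos hc]
        rw [h]
        exact hstep J ih
      · have h : L (J + 1) = L J := by
          change G.lastSel μ f r A (J + 1) x = _
          rw [lastSel, if_neg hc]
        rw [h]
        exact ih
  have hIcc : Finset.Icc 0 J = Finset.range (J + 1) := by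
    ext i
    simp only [Finset.mem_range, Finset.mem_Icc]
    omega
  simp only [maxAvg, hIcc]
  exact hstep J (hprev J)

section Sparse

variable (G μ f r A) in
/-- The part of the selected cells of level `j` that lies in no selected cell of a later level
`≤ J`. -/
def core (J j : ℕ) : Set X :=
  G.sel μ f r A j \ ⋃ i ∈ Finset.Ioc j J, G.sel μ f r A i

variable [Countable ι]

lemma measurableSet_sel (j : ℕ) : MeasurableSet (G.sel μ f r A j) :=
  measurableSet_of_level (j := j) fun _ _ h => mem_sel_of_idx_eq h

lemma measurableSet_core (J j : ℕ) : MeasurableSet (G.core μ f r A J j) :=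
  (measurableSet_sel j).diff (Finset.measurableSet_biUnion _ fun i _ => measurableSet_sel i)

/-- The selected cells form a sparse family. -/
lemma measure_cell_le_two_mul [SFinite μ] (hfin : ∀ j x, μ (G.cell j x) ≠ ⊤)
    (hpos : ∀ j x, μ (G.cell j x) ≠ 0) {D : ℝ≥0∞}
    (hD1 : 1 ≤ D) (hDt : D ≠ ⊤) (hD : ∀ j x, μ (G.cell j x) ≤ D * μ (G.cell (j + 1) x))
    (hf : ∀ k, Measurable (f k)) (hr : 1 < r) (hA : A = 2 * weakConst r D) (hAt : A ≠ ⊤)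
    {J j : ℕ} (hj : j ≤ J) {x : X} (hx : x ∈ G.sel μ f r A j) :
    μ (G.cell j x) ≤ 2 * μ (G.cell j x ∩ G.core μ f r A J j) := by
  have hr0 : 0 < r := by linarith
  have hW1 : 1 ≤ weakConst r D := le_self_add
  have hA1 : 1 ≤ A := by
    rw [hA, two_mul]
    exact hW1.trans le_self_add
  have hWt : weakConst r D ≠ ⊤ := by
    intro h
    rw [hA, h] at hAt
    exact hAt (by simp)
  set U := ⋃ i ∈ Finset.Ioc j J, G.sel μ f r A i with hU
  have hUm : MeasurableSet U := Finset.measurableSet_biUnion _ fun i _ => measurableSet_sel i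
  have hsub : G.cell j x ∩ U ⊆ G.cell j x ∩
      {y | (A * G.avg μ j (fun y => ellNorm r fun k => f k y) x) ^ r <
        ∑' k, G.maxAvg μ j J (f k) y ^ r} := by
    rintro y ⟨hy, hyU⟩
    refine ⟨hy, ?_⟩
    have hy' : G.idx j y = G.idx j x := hy
    simp only [hU, mem_iUnion, exists_prop] at hyU
    obtain ⟨i, hi, hyi⟩ := hyU
    obtain ⟨hi1, hi2⟩ := Finset.mem_Ioc.1 hi
    have hyi : G.lastSel μ f r A i y = i := hyi
    obtain ⟨l, hl1, hl2, hl⟩ := exists_of_lastSel_ne hi1.le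
      (mem_sel_of_idx_eq hy'.symm hx) (by rw [hyi]; omega)
    rw [isLevel_avg j _ y x hy'] at hl
    refine hl.trans_le (ENNReal.tsum_le_tsum fun k => ENNReal.rpow_le_rpow ?_ hr0.le)
    exact Finset.sup_mono (Finset.Icc_subset_Icc le_rfl (hl2.trans hi2))
  have h2 : 2 * μ (G.cell j x ∩ U) ≤ μ (G.cell j x) := by
    have h := meas_cell_inter_le hfin hD1 hDt hD hf hr hj hA1 hAt x (hpos j x)
    rw [← ENNReal.mul_le_mul_iff_right (zero_lt_one.trans_le hW1).ne' hWt]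
    refine le_trans ?_ h
    rw [← mul_assoc, mul_comm _ 2, ← hA]
    exact mul_le_mul_right (measure_mono hsub) _
  have hcore : G.cell j x ∩ G.core μ f r A J j = G.cell j x \ U := by
    ext y
    constructor
    · exact fun hy => ⟨hy.1, hy.2.2⟩
    · exact fun hy => ⟨hy.1, mem_sel_of_idx_eq (Eq.symm hy.1) hx, hy.2⟩
  rw [hcore]
  have hsplit := measure_inter_add_sdiff (μ := μ) (G.cell j x) hUm
  have hit : μ (G.cell j x ∩ U) ≠ ⊤ :=
    ne_top_of_le_ne_top (hfin j x) (measure_mono inter_subset_left)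
  have h3 : μ (G.cell j x ∩ U) + μ (G.cell j x ∩ U) ≤
      μ (G.cell j x ∩ U) + μ (G.cell j x \ U) := by
    rw [hsplit, ← two_mul]; exact h2
  have h4 := (ENNReal.add_le_add_iff_left hit).1 h3
  rw [two_mul]
  nth_rewrite 1 [← hsplit]
  exact add_le_add_left h4 _

/-- Summing over a family of cells that is sparse for `ν` costs no more than a constant. -/
lemma sum_setLIntegral_sel_le {L : ℝ≥0∞} {J : ℕ}
    (hL : ∀ j ≤ J, ∀ x ∈ G.sel μ f r A j,
      ν (G.cell j x) ≤ L * ν (G.cell j x ∩ G.core μ f r A J j))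
    {φ : ℕ → X → ℝ≥0∞} (hφ : ∀ j, G.IsLevel j (φ j)) {m : X → ℝ≥0∞}
    (hφm : ∀ j ≤ J, ∀ x, φ j x ≤ m x) :
    ∑ j ∈ Finset.range (J + 1), ∫⁻ x in G.sel μ f r A j, φ j x ∂ν ≤ L * ∫⁻ x, m x ∂ν := by
  have hdisj : (↑(Finset.range (J + 1)) : Set ℕ).PairwiseDisjoint (G.core μ f r A J) := by
    have key : ∀ i ∈ Finset.range (J + 1), ∀ j ∈ Finset.range (J + 1), i < j →
        Disjoint (G.core μ f r A J i) (G.core μ f r A J j) := by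
      intro i _ j hj hij
      rw [Set.disjoint_left]
      intro x hxi hxj
      refine hxi.2 ?_
      simp only [mem_iUnion, exists_prop]
      exact ⟨j, Finset.mem_Ioc.2 ⟨hij, by simpa [Nat.lt_succ_iff] using hj⟩, hxj.1⟩
    intro i hi j hj hij
    rcases lt_or_gt_of_ne hij with h | h
    · exact key i hi j hj h
    · exact (key j hj i hi h).symm
  calc ∑ j ∈ Finset.range (J + 1), ∫⁻ x in G.sel μ f r A j, φ j x ∂ν
      ≤ ∑ j ∈ Finset.range (J + 1), L * ∫⁻ x in G.core μ f r A J j, m x ∂ν := by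
        refine Finset.sum_le_sum fun j hj => ?_
        have hjJ : j ≤ J := by simpa [Nat.lt_succ_iff] using hj
        have hcell : ∀ x ∈ G.sel μ f r A j, ∫⁻ y in G.cell j x, φ j y ∂ν ≤
            ∫⁻ y in G.cell j x, φ j y ∂(L • ν.restrict (G.core μ f r A J j)) := by
          intro x hx
          have hc : ∀ ρ : Measure X, ∫⁻ y in G.cell j x, φ j y ∂ρ = φ j x * ρ (G.cell j x) := by
            intro ρ
            rw [← setLIntegral_const]
            exact setLIntegral_congr_fun (measurableSet_cell j x) fun y hy => hφ j y x hy
          rw [hc, hc, Measure.smul_apply, Measure.restrict_apply (measurableSet_cell j x),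
            smul_eq_mul]
          exact mul_le_mul_right (hL j hjJ x hx) _
        refine (setLIntegral_le_of_cell (fun x y h => mem_sel_of_idx_eq h) hcell).trans ?_
        rw [Measure.restrict_smul, lintegral_smul_measure, smul_eq_mul]
        refine mul_le_mul_right ?_ _
        exact (setLIntegral_le_lintegral _ _).trans (lintegral_mono fun x => hφm j hjJ x)
    _ = L * ∫⁻ x in ⋃ j ∈ Finset.range (J + 1), G.core μ f r A J j, m x ∂ν := by
        rw [← Finset.mul_sum, lintegral_biUnion_finset hdisj fun j _ => measurableSet_core J j]
    _ ≤ L * ∫⁻ x, m x ∂ν := mul_le_mul_right (setLIntegral_le_lintegral _ _) _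

end Sparse

end Grid

/-! ### Weak-type bounds for a pair of measures -/

/-- The `L^{p,1}(ν)` norm in terms of the distribution function, `∫_0^∞ ν(F > s)^{1/p} ds`. -/
def lorentzOne {X : Type*} [MeasurableSpace X] (ν : Measure X) (p : ℝ) (F : X → ℝ≥0∞) : ℝ≥0∞ :=
  ∫⁻ s in Ioi (0 : ℝ), ν {x | ENNReal.ofReal s < F x} ^ (1 / p)

/-- A weak-type bound follows from a bound by duality against sets of finite measure. -/
lemma mul_rpow_le_of_forall_subset {X : Type*} [MeasurableSpace X] {ν : Measure X} [SigmaFinite ν]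
    {p : ℝ} (hp : 1 < p) {H : Set X} (hH : MeasurableSet H) {lam B : ℝ≥0∞} (hl0 : lam ≠ 0)
    (hlt : lam ≠ ⊤)
    (h : ∀ Z, MeasurableSet Z → Z ⊆ H → ν Z ≠ ⊤ → lam * ν Z ≤ B * ν Z ^ (1 - 1 / p)) :
    lam * ν H ^ (1 / p) ≤ B := by
  have hp0 : 0 < p := by linarith
  have h1p : 0 < 1 / p := by positivity
  have h1p' : 1 / p ≤ 1 := by rw [div_le_one hp0]; exact hp.le
  have key : ∀ Z, MeasurableSet Z → Z ⊆ H → ν Z ≠ ⊤ → lam * ν Z ^ (1 / p) ≤ B := by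
    intro Z hZ hZH hZt
    rcases eq_or_ne (ν Z) 0 with h0 | h0
    · rw [h0, ENNReal.zero_rpow_of_pos h1p, mul_zero]
      exact zero_le
    have hne0 : ν Z ^ (1 - 1 / p) ≠ 0 := by simp [ENNReal.rpow_eq_zero_iff, h0, hZt]
    have hnet : ν Z ^ (1 - 1 / p) ≠ ⊤ := ENNReal.rpow_ne_top_of_nonneg (by linarith) hZt
    rw [← ENNReal.mul_le_mul_iff_left hne0 hnet]
    refine le_of_eq_of_le ?_ (h Z hZ hZH hZt)
    rw [mul_assoc, ← ENNReal.rpow_add _ _ h0 hZt, add_sub_cancel, ENNReal.rpow_one]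
  by_contra hcon
  rw [not_le] at hcon
  have h1 : (B / lam) ^ p < ν H := by
    have : B / lam < ν H ^ (1 / p) := by
      rwa [ENNReal.div_lt_iff (Or.inl hl0) (Or.inl hlt), mul_comm]
    have h2 := ENNReal.rpow_lt_rpow this hp0
    rwa [← ENNReal.rpow_mul, one_div_mul_cancel hp0.ne', ENNReal.rpow_one] at h2
  obtain ⟨Z, hZ, hZH, hlt1, hZt⟩ := Measure.exists_subset_measure_lt_top hH h1
  have h3 := key Z hZ hZH hZt.ne
  refine absurd h3 (not_le.2 ?_)
  rw [mul_comm, ← ENNReal.div_lt_iff (Or.inl hl0) (Or.inl hlt)]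
  have h2 := ENNReal.rpow_lt_rpow hlt1 h1p
  rwa [← ENNReal.rpow_mul, mul_one_div_cancel hp0.ne', ENNReal.rpow_one] at h2

/-- Hölder's inequality against the constant `1` on a set. -/
lemma setLIntegral_rpow_one_div_le {X : Type*} [MeasurableSpace X] {ν : Measure X} {p : ℝ}
    (hp : 1 < p) {h : X → ℝ≥0∞} (hh : Measurable h) (Z : Set X) :
    ∫⁻ x in Z, h x ^ (1 / p) ∂ν ≤ (∫⁻ x in Z, h x ∂ν) ^ (1 / p) * ν Z ^ (1 - 1 / p) := by
  have hp0 : 0 < p := by linarith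
  have hc := Real.HolderConjugate.conjExponent hp
  have hH := ENNReal.lintegral_mul_le_Lp_mul_Lq (ν.restrict Z) hc
    (f := fun x => h x ^ (1 / p)) (g := fun _ => 1) (hh.pow_const _).aemeasurable
    aemeasurable_const
  have he : 1 / p.conjExponent = 1 - 1 / p := by
    rw [one_div, one_div, hc.one_sub_inv]
  simpa [← ENNReal.rpow_mul, hp0.ne', he] using hH

lemma doobConst_ne_top {b : ℝ} (hb : 0 ≤ b) : Grid.doobConst b ≠ ⊤ :=
  ENNReal.mul_ne_top ENNReal.ofReal_ne_top (ENNReal.rpow_ne_top_of_nonneg hb (by simp))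

namespace Grid

variable {X ι : Type*} [MeasurableSpace X] {G : Grid X ι} {μ ν : Measure X}

lemma weakConst_ne_top {r : ℝ} (hr : 1 < r) {D : ℝ≥0∞} (hD : D ≠ ⊤) : weakConst r D ≠ ⊤ :=
  ENNReal.add_ne_top.2 ⟨by simp, ENNReal.mul_ne_top (doobConst_ne_top (by linarith))
    (ENNReal.rpow_ne_top_of_nonneg (by linarith) hD)⟩

variable (G μ) in
/-- All cells have positive finite measure. -/
def Charged : Prop := ∀ j x, μ (G.cell j x) ≠ 0 ∧ μ (G.cell j x) ≠ ⊤

variable (G μ ν) in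
/-- The condition `|E| / |Q| ≤ K (ν(E) / ν(Q))^{1/p}` for measurable subsets `E` of cells `Q`. -/
def Comparable (p : ℝ) (K : ℝ≥0∞) : Prop :=
  ∀ j x E, MeasurableSet E → E ⊆ G.cell j x →
    μ E * ν (G.cell j x) ^ (1 / p) ≤ K * μ (G.cell j x) * ν E ^ (1 / p)

variable {p q : ℝ} {K : ℝ≥0∞}

lemma avg_indicator_one {j : ℕ} {x : X} {H : Set X} (hH : MeasurableSet H) :
    G.avg μ j (H.indicator fun _ => 1) x = (μ (G.cell j x))⁻¹ * μ (H ∩ G.cell j x) := by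
  rw [avg, lintegral_indicator hH, lintegral_one, Measure.restrict_apply_univ,
    Measure.restrict_apply hH]

lemma Comparable.avg_indicator_le (hp : 0 < p) (hK : G.Comparable μ ν p K) (hμ : G.Charged μ)
    (hν : G.Charged ν) {H : Set X} (hH : MeasurableSet H) (j : ℕ) (x : X) :
    G.avg μ j (H.indicator fun _ => 1) x ≤
      K * G.avg ν j (H.indicator fun _ => 1) x ^ (1 / p) := by
  have h := hK j x (H ∩ G.cell j x) (hH.inter (measurableSet_cell j x)) inter_subset_right
  rw [avg_indicator_one hH, avg_indicator_one hH,
    ENNReal.mul_rpow_of_nonneg _ _ (by positivity), ENNReal.inv_rpow]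
  set a := μ (G.cell j x)
  set b := ν (G.cell j x) ^ (1 / p) with hb
  have hb0 : b ≠ 0 := by simp [hb, ENNReal.rpow_eq_zero_iff, hν j x]
  have hbt : b ≠ ⊤ := ENNReal.rpow_ne_top_of_nonneg (by positivity) (hν j x).2
  calc a⁻¹ * μ (H ∩ G.cell j x) = a⁻¹ * b⁻¹ * (μ (H ∩ G.cell j x) * b) := by
        rw [mul_comm (μ _) b, mul_assoc, ← mul_assoc b⁻¹, ENNReal.inv_mul_cancel hb0 hbt, one_mul]
    _ ≤ a⁻¹ * b⁻¹ * (K * a * ν (H ∩ G.cell j x) ^ (1 / p)) := mul_le_mul_right h _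
    _ = a⁻¹ * a * (K * (b⁻¹ * ν (H ∩ G.cell j x) ^ (1 / p))) := by ring
    _ = _ := by rw [ENNReal.inv_mul_cancel (hμ j x).1 (hμ j x).2, one_mul]

/-- A set that fills half of a cell for `μ` fills a fixed proportion of it for `ν`. -/
lemma Comparable.measure_cell_le (hp : 0 < p) (hK : G.Comparable μ ν p K) (hμ : G.Charged μ)
    {j : ℕ} {x : X} {E : Set X} (hE : MeasurableSet E) (hsub : E ⊆ G.cell j x)
    (h2 : μ (G.cell j x) ≤ 2 * μ E) : ν (G.cell j x) ≤ (2 * K) ^ p * ν E := by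
  have h := hK j x E hE hsub
  have h1 : ν (G.cell j x) ^ (1 / p) ≤ 2 * K * ν E ^ (1 / p) := by
    rw [← ENNReal.mul_le_mul_iff_right (hμ j x).1 (hμ j x).2]
    calc μ (G.cell j x) * ν (G.cell j x) ^ (1 / p)
        ≤ 2 * μ E * ν (G.cell j x) ^ (1 / p) := mul_le_mul_left h2 _
      _ = 2 * (μ E * ν (G.cell j x) ^ (1 / p)) := by ring
      _ ≤ 2 * (K * μ (G.cell j x) * ν E ^ (1 / p)) := mul_le_mul_right h _
      _ = _ := by ring
  have h3 := ENNReal.rpow_le_rpow h1 hp.le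
  rwa [ENNReal.mul_rpow_of_nonneg _ _ hp.le, ← ENNReal.rpow_mul, ← ENNReal.rpow_mul,
    one_div_mul_cancel hp.ne', ENNReal.rpow_one, ENNReal.rpow_one] at h3

lemma avg_eq_lintegral_avg_indicator [SFinite μ] {F : X → ℝ≥0∞} (hF : Measurable F) (j : ℕ)
    (x : X) : G.avg μ j F x =
      ∫⁻ s in Ioi (0 : ℝ), G.avg μ j ({y | ENNReal.ofReal s < F y}.indicator fun _ => 1) x := by
  simp only [avg]
  rw [lintegral_const_mul, lintegral_eq_lintegral_lintegral_indicator hF]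
  refine Antitone.measurable fun s s' hss => lintegral_mono fun y => ?_
  refine indicator_le_indicator_of_subset (fun y hy => ?_) (fun _ => zero_le) y
  exact (ENNReal.ofReal_le_ofReal hss).trans_lt hy

lemma measurable_avg_indicator_lt (F : X → ℝ≥0∞) (j : ℕ) (x : X) :
    Measurable fun s : ℝ => G.avg μ j ({y | ENNReal.ofReal s < F y}.indicator fun _ => 1) x := by
  refine Antitone.measurable fun s s' hss => avg_mono fun y => ?_
  refine indicator_le_indicator_of_subset (fun y hy => ?_) (fun _ => zero_le) y
  exact (ENNReal.ofReal_le_ofReal hss).trans_lt hy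

variable [Countable ι]

lemma measurable_uncurry_of_level {J : ℕ} {u : X → ℝ → ℝ≥0∞}
    (hu : ∀ s, G.IsLevel J fun x => u x s) (hm : ∀ x, Measurable (u x)) :
    Measurable (Function.uncurry u) := by
  intro B hB
  have : Function.uncurry u ⁻¹' B = ⋃ i : range (G.idx J),
      (G.idx J ⁻¹' {(i : ι)}) ×ˢ (u i.2.choose ⁻¹' B) := by
    ext ⟨x, s⟩
    simp only [mem_preimage, Function.uncurry_apply_pair, mem_iUnion, mem_prod,
      mem_singleton_iff]
    constructor
    · intro h
      refine ⟨⟨G.idx J x, x, rfl⟩, rfl, ?_⟩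
      have hc := Exists.choose_spec (p := fun y => G.idx J y = G.idx J x) ⟨x, rfl⟩
      have hu' : u _ s = u x s := hu s _ x hc
      rwa [hu']
    · rintro ⟨⟨i, hi⟩, hx, h⟩
      have hc : G.idx J hi.choose = i := hi.choose_spec
      have hu' : u x s = u _ s := hu s x _ (hx.trans hc.symm)
      rwa [hu']
  rw [this]
  exact MeasurableSet.iUnion fun i => (G.measurableSet_fiber J i).prod (hm _ hB)

/-- The scalar weak-type inequality `L^{p,1}(ν) → L^{p,∞}(ν)` for the maximal function of `μ`. -/
lemma mul_meas_lt_maxAvg_rpow_le [SFinite μ] [SigmaFinite ν] (hp : 1 < p)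
    (hK : G.Comparable μ ν p K) (hμ : G.Charged μ) (hν : G.Charged ν) {F : X → ℝ≥0∞}
    (hF : Measurable F) (J : ℕ) {lam : ℝ≥0∞} (hl0 : lam ≠ 0) (hlt : lam ≠ ⊤) :
    lam * ν {x | lam < G.maxAvg μ 0 J F x} ^ (1 / p) ≤ K * lorentzOne ν p F := by
  have hp0 : 0 < p := by linarith
  refine mul_rpow_le_of_forall_subset hp
    (measurableSet_lt measurable_const (measurable_maxAvg 0 J F)) hl0 hlt fun Z hZ hZH hZt => ?_
  set t := G.hit μ F lam J with ht
  have hts : G.IsStopping t := isStopping_hit F lam J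
  set E : ℝ → Set X := fun s => {y | ENNReal.ofReal s < F y} with hE
  have hEm : ∀ s, MeasurableSet (E s) := fun s => measurableSet_lt measurable_const hF
  calc lam * ν Z = ∫⁻ _ in Z, lam ∂ν := by rw [setLIntegral_const]
    _ ≤ ∫⁻ x in Z, G.avg μ (t x) F x ∂ν :=
        setLIntegral_mono' hZ fun x hx => (lt_avg_hit (hZH hx)).le
    _ = ∫⁻ x in Z, (∫⁻ s in Ioi (0 : ℝ), G.avg μ (t x) ((E s).indicator fun _ => 1) x) ∂ν :=
        lintegral_congr fun x => avg_eq_lintegral_avg_indicator hF _ x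
    _ = ∫⁻ s in Ioi (0 : ℝ), ∫⁻ x in Z, G.avg μ (t x) ((E s).indicator fun _ => 1) x ∂ν := by
        refine lintegral_lintegral_swap (Measurable.aemeasurable ?_)
        exact measurable_uncurry_of_level (J := J)
          (fun s => hts.isLevel_comp (hit_le F lam J)
            (φ := fun j => G.avg μ j ((E s).indicator fun _ => 1)) fun j => isLevel_avg j _)
          fun x => measurable_avg_indicator_lt F (t x) x
    _ ≤ ∫⁻ s in Ioi (0 : ℝ), K * (ν (E s) ^ (1 / p) * ν Z ^ (1 - 1 / p)) := by
        refine lintegral_mono fun s => ?_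
        have hgm : Measurable fun x => G.avg ν (t x) ((E s).indicator fun _ => 1) x :=
          (hts.isLevel_comp (hit_le F lam J)
            (φ := fun j => G.avg ν j ((E s).indicator fun _ => 1)) fun j =>
              isLevel_avg j _).measurable
        calc ∫⁻ x in Z, G.avg μ (t x) ((E s).indicator fun _ => 1) x ∂ν
            ≤ ∫⁻ x in Z, K * G.avg ν (t x) ((E s).indicator fun _ => 1) x ^ (1 / p) ∂ν :=
              lintegral_mono fun x => hK.avg_indicator_le hp0 hμ hν (hEm s) _ x
          _ = K * ∫⁻ x in Z, G.avg ν (t x) ((E s).indicator fun _ => 1) x ^ (1 / p) ∂ν :=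
              lintegral_const_mul _ (hgm.pow_const _)
          _ ≤ K * (ν (E s) ^ (1 / p) * ν Z ^ (1 - 1 / p)) := by
              refine mul_le_mul_right ((setLIntegral_rpow_one_div_le hp hgm Z).trans ?_) _
              refine mul_le_mul_left (ENNReal.rpow_le_rpow ?_ (by positivity)) _
              refine (setLIntegral_le_lintegral _ _).trans_eq ?_
              rw [lintegral_stopped (fun j x => (hν j x).2) hts
                (measurable_const.indicator (hEm s)), lintegral_indicator (hEm s)]
              simp
    _ = K * lorentzOne ν p F * ν Z ^ (1 - 1 / p) := by
        have h1p : 1 / p ≤ 1 := by rw [div_le_one hp0]; exact hp.le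
        have hm : Measurable fun s : ℝ => ν (E s) ^ (1 / p) := by
          refine Antitone.measurable fun s s' hss =>
            ENNReal.rpow_le_rpow (measure_mono fun y hy => ?_) (by positivity)
          exact (ENNReal.ofReal_le_ofReal hss).trans_lt hy
        rw [lintegral_const_mul _ (hm.mul_const _), lintegral_mul_const _ hm, lorentzOne, mul_assoc]

lemma maxAvg_indicator_rpow_le [SFinite ν] (hν : G.Charged ν) {H : Set X} (hH : MeasurableSet H)
    (J : ℕ) {b : ℝ} (hb : 1 < b) :
    ∫⁻ x, G.maxAvg ν 0 J (H.indicator fun _ => 1) x ^ b ∂ν ≤ doobConst b * ν H := by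
  refine (lintegral_maxAvg_rpow_le (fun j x => (hν j x).2)
    (measurable_const.indicator hH) J hb).trans_eq ?_
  congr 1
  rw [← setLIntegral_one, ← lintegral_indicator hH]
  refine lintegral_congr fun x => ?_
  by_cases hx : x ∈ H
  · simp [hx]
  · simp [hx, ENNReal.zero_rpow_of_pos (zero_lt_one.trans hb)]

/-- The vector-valued weak-type bound below the exponent of the sequence space, with a constant
depending on `p`, `r`, `K` and `D` only. Where the scalar maximal function `m` of `|f|_r` is at most
`lam`, the selected averages may be truncated at `lam`, and the sum of their `r`-th powers is
integrated by sparseness against `min m lam ^ r`; this converges because `p < r`. -/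
theorem exists_weak_bound_of_lt (hp : 1 < p) {r : ℝ} (hpr : p < r) (hKt : K ≠ ⊤) {D : ℝ≥0∞}
    (hD1 : 1 ≤ D) (hDt : D ≠ ⊤) : ∃ C : ℝ≥0∞, C ≠ ⊤ ∧ ∀ (X ι : Type) [MeasurableSpace X]
      [Countable ι] (G : Grid X ι) (μ ν : Measure X) [SFinite μ] [SigmaFinite ν],
      G.Comparable μ ν p K → G.Charged μ → G.Charged ν →
      (∀ j x, μ (G.cell j x) ≤ D * μ (G.cell (j + 1) x)) →
      ∀ f : ℕ → X → ℝ≥0∞, (∀ k, Measurable (f k)) → ∀ (J : ℕ) (lam : ℝ≥0∞), lam ≠ 0 → lam ≠ ⊤ →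
        lam * ν {x | lam ^ r < ∑' k, G.maxAvg μ 0 J (f k) x ^ r} ^ (1 / p) ≤
          C * lorentzOne ν p fun x => ellNorm r fun k => f k x := by
  have hp0 : 0 < p := by linarith
  have hr0 : 0 < r := by linarith
  have hr : 1 < r := by linarith
  set A : ℝ≥0∞ := 2 * weakConst r D with hA
  have hAt : A ≠ ⊤ := ENNReal.mul_ne_top (by simp) (weakConst_ne_top hr hDt)
  have hA1 : 1 ≤ A := by
    rw [hA, two_mul]
    exact (le_self_add : (1 : ℝ≥0∞) ≤ weakConst r D).trans le_self_add
  set L : ℝ≥0∞ := (2 * K) ^ p with hL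
  have hLt : L ≠ ⊤ := ENNReal.rpow_ne_top_of_nonneg hp0.le (ENNReal.mul_ne_top (by simp) hKt)
  set R : ℝ≥0∞ := ENNReal.ofReal (r / (r - p)) with hR
  set C' : ℝ≥0∞ := 1 + A ^ r * (L * R) with hC'
  have hC't : C' ≠ ⊤ := ENNReal.add_ne_top.2 ⟨by simp, ENNReal.mul_ne_top
    (ENNReal.rpow_ne_top_of_nonneg hr0.le hAt) (ENNReal.mul_ne_top hLt ENNReal.ofReal_ne_top)⟩
  refine ⟨C' ^ (1 / p) * K, ENNReal.mul_ne_top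
    (ENNReal.rpow_ne_top_of_nonneg (by positivity) hC't) hKt, ?_⟩
  intro X ι _ _ G μ ν _ _ hK hμ hν hD f hf J lam hl0 hlt
  set F : X → ℝ≥0∞ := fun x => ellNorm r fun k => f k x with hF
  have hFm : Measurable F := measurable_ellNorm hf r
  set B : ℝ≥0∞ := K * lorentzOne ν p F with hB
  set m : X → ℝ≥0∞ := G.maxAvg μ 0 J F with hm
  have hmm : Measurable m := measurable_maxAvg 0 J F
  -- the scalar weak-type bound, in power form
  have hweak : ∀ s : ℝ≥0∞, s ≠ 0 → s ≠ ⊤ → s ^ p * ν {x | s < m x} ≤ B ^ p := by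
    intro s hs0 hst
    have h := ENNReal.rpow_le_rpow
      (mul_meas_lt_maxAvg_rpow_le hp hK hμ hν hFm J hs0 hst) hp0.le
    rwa [ENNReal.mul_rpow_of_nonneg _ _ hp0.le, ← ENNReal.rpow_mul, one_div_mul_cancel hp0.ne',
      ENNReal.rpow_one] at h
  have hmin : ∫⁻ x, min (m x) lam ^ r ∂ν ≤ R * (B ^ p * lam ^ (r - p)) := by
    have hmm' : Measurable fun x => min (m x) lam := hmm.min measurable_const
    rw [lintegral_rpow_eq_lintegral_meas hmm' hr0]
    calc ∫⁻ s in Ioi (0 : ℝ), ENNReal.ofReal (r * s ^ (r - 1)) *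
          ν {x | ENNReal.ofReal s < min (m x) lam}
        ≤ ∫⁻ s in Ioi (0 : ℝ), R * (B ^ p * {s : ℝ | ENNReal.ofReal s < lam}.indicator
            (fun s => ENNReal.ofReal ((r - p) * s ^ (r - p - 1))) s) := by
          refine setLIntegral_mono' measurableSet_Ioi fun s (hs : 0 < s) => ?_
          by_cases hsl : ENNReal.ofReal s < lam
          · have h1 : {x | ENNReal.ofReal s < min (m x) lam} = {x | ENNReal.ofReal s < m x} := by
              ext x
              simp [hsl]
            have h2 := hweak (ENNReal.ofReal s) (by simpa using hs) ENNReal.ofReal_ne_top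
            have h3 : ENNReal.ofReal (r * s ^ (r - 1)) =
                R * ENNReal.ofReal ((r - p) * s ^ (r - p - 1)) * ENNReal.ofReal s ^ p := by
              have hrp : 0 < r - p := by linarith
              rw [hR, ENNReal.ofReal_rpow_of_pos hs, ← ENNReal.ofReal_mul (by positivity),
                ← ENNReal.ofReal_mul (by positivity)]
              congr 1
              have : s ^ (r - 1) = s ^ (r - p - 1) * s ^ p := by
                rw [← Real.rpow_add hs]; congr 1; ring
              rw [this]
              field_simp
            rw [h1, h3, indicator_of_mem (by exact hsl), mul_assoc]
            refine (mul_le_mul_right h2 _).trans_eq ?_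
            ring
          · have h1 : {x | ENNReal.ofReal s < min (m x) lam} = ∅ := by
              ext x
              simp only [lt_min_iff, hsl, and_false]
              exact Iff.rfl
            rw [h1, measure_empty, mul_zero]
            exact zero_le
      _ = R * (B ^ p * lam ^ (r - p)) := by
          have hmeas : Measurable fun s : ℝ => {s : ℝ | ENNReal.ofReal s < lam}.indicator
              (fun s => ENNReal.ofReal ((r - p) * s ^ (r - p - 1))) s :=
            Measurable.indicator (by fun_prop)
              (measurableSet_lt ENNReal.measurable_ofReal measurable_const)
          rw [lintegral_const_mul _ (hmeas.const_mul _), lintegral_const_mul _ hmeas,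
            lintegral_indicator_rpow_weight (by linarith)]
  have hsparse : ∀ j ≤ J, ∀ x ∈ G.sel μ f r A j,
      ν (G.cell j x) ≤ L * ν (G.cell j x ∩ G.core μ f r A J j) := fun j hj x hx =>
    hK.measure_cell_le hp0 hμ ((measurableSet_cell j x).inter (measurableSet_core J j))
      inter_subset_left (measure_cell_le_two_mul (fun j x => (hμ j x).2) (fun j x => (hμ j x).1)
        hD1 hDt hD hf hr hA hAt hj hx)
  set φ : ℕ → X → ℝ≥0∞ := fun j x => min (G.avg μ j F x) lam ^ r with hφ
  have hφl : ∀ j, G.IsLevel j (φ j) := fun j x y h => by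
    simp only [hφ, isLevel_avg j F x y h]
  set T : X → ℝ≥0∞ := fun x => ∑ j ∈ Finset.range (J + 1), (G.sel μ f r A j).indicator (φ j) x
    with hT
  have hTm : Measurable T := Finset.measurable_sum _ fun j _ =>
    ((hφl j).measurable).indicator (measurableSet_sel j)
  have hTint : ∫⁻ x, T x ∂ν ≤ L * (R * (B ^ p * lam ^ (r - p))) := by
    rw [hT, lintegral_finsetSum _ fun j _ => ((hφl j).measurable).indicator (measurableSet_sel j)]
    simp_rw [lintegral_indicator (measurableSet_sel _)]
    refine (sum_setLIntegral_sel_le hsparse hφl (m := fun x => min (m x) lam ^ r)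
      fun j hj x => ?_).trans (mul_le_mul_right hmin _)
    refine ENNReal.rpow_le_rpow (min_le_min_right _ ?_) hr0.le
    exact Finset.le_sup (f := fun i => G.avg μ i F x) (Finset.mem_Icc.2 ⟨Nat.zero_le j, hj⟩)
  have hsub : {x | lam ^ r < ∑' k, G.maxAvg μ 0 J (f k) x ^ r} ⊆
      {x | lam < m x} ∪ {x | lam ^ r ≤ A ^ r * T x} := by
    intro x (hx : lam ^ r < ∑' k, G.maxAvg μ 0 J (f k) x ^ r)
    by_cases hxm : lam < m x
    · exact Or.inl hxm
    refine Or.inr (hx.le.trans ((tsum_maxAvg_le_sum_sel hf hr hA1 J x).trans ?_))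
    rw [hT, Finset.mul_sum]
    refine Finset.sum_le_sum fun j hj => ?_
    by_cases hxs : x ∈ G.sel μ f r A j
    · rw [indicator_of_mem hxs, indicator_of_mem hxs, ENNReal.mul_rpow_of_nonneg _ _ hr0.le, hφ]
      have hle : G.avg μ j F x ≤ lam := (Finset.le_sup (f := fun i => G.avg μ i F x)
        (Finset.mem_Icc.2 ⟨Nat.zero_le j, by simpa [Nat.lt_succ_iff] using hj⟩)).trans
          (not_lt.1 hxm)
      simp only [min_eq_left hle]
      exact le_rfl
    · simp [hxs]
  have hpow : lam ^ p * ν {x | lam ^ r < ∑' k, G.maxAvg μ 0 J (f k) x ^ r} ≤ C' * B ^ p := by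
    have h2 : lam ^ p * ν {x | lam ^ r ≤ A ^ r * T x} ≤ A ^ r * (L * R) * B ^ p := by
      have hne0 : lam ^ (r - p) ≠ 0 := by simp [ENNReal.rpow_eq_zero_iff, hl0, hlt]
      have hnet : lam ^ (r - p) ≠ ⊤ := ENNReal.rpow_ne_top_of_nonneg (by linarith) hlt
      rw [← ENNReal.mul_le_mul_iff_right hne0 hnet, ← mul_assoc,
        ← ENNReal.rpow_add_of_nonneg _ _ (by linarith) hp0.le, sub_add_cancel]
      refine (mul_meas_ge_le_lintegral (hTm.const_mul _) _).trans ?_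
      rw [lintegral_const_mul _ hTm]
      refine (mul_le_mul_right hTint _).trans_eq ?_
      ring
    calc lam ^ p * ν {x | lam ^ r < ∑' k, G.maxAvg μ 0 J (f k) x ^ r}
        ≤ lam ^ p * (ν {x | lam < m x} + ν {x | lam ^ r ≤ A ^ r * T x}) :=
          mul_le_mul_right ((measure_mono hsub).trans (measure_union_le _ _)) _
      _ ≤ B ^ p + A ^ r * (L * R) * B ^ p := by
          rw [mul_add]
          exact add_le_add (hweak lam hl0 hlt) h2
      _ = C' * B ^ p := by rw [hC', add_mul, one_mul]
  have hfin := ENNReal.rpow_le_rpow hpow (z := 1 / p) (by positivity)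
  rwa [ENNReal.mul_rpow_of_nonneg _ _ (by positivity),
    ENNReal.mul_rpow_of_nonneg _ _ (by positivity), ← ENNReal.rpow_mul, ← ENNReal.rpow_mul,
    mul_one_div_cancel hp0.ne', ENNReal.rpow_one, ENNReal.rpow_one, hB, ← mul_assoc] at hfin

/-- The vector-valued weak-type bound under a comparability condition with a smaller exponent. The
`ℓ^r` norm of the selected averages is at most their sum, which is linear in `|f|_r` and is
estimated by duality. -/
theorem exists_weak_bound_of_comparable_lt (hq : 1 < q) (hqp : q < p) {r : ℝ} (hr : 1 < r)
    (hKt : K ≠ ⊤) {D : ℝ≥0∞} (hD1 : 1 ≤ D) (hDt : D ≠ ⊤) :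
    ∃ C : ℝ≥0∞, C ≠ ⊤ ∧ ∀ (X ι : Type) [MeasurableSpace X]
      [Countable ι] (G : Grid X ι) (μ ν : Measure X) [SFinite μ] [SigmaFinite ν],
      G.Comparable μ ν q K → G.Charged μ → G.Charged ν →
      (∀ j x, μ (G.cell j x) ≤ D * μ (G.cell (j + 1) x)) →
      ∀ f : ℕ → X → ℝ≥0∞, (∀ k, Measurable (f k)) → ∀ (J : ℕ) (lam : ℝ≥0∞), lam ≠ 0 → lam ≠ ⊤ →
        lam * ν {x | lam ^ r < ∑' k, G.maxAvg μ 0 J (f k) x ^ r} ^ (1 / p) ≤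
          C * lorentzOne ν p fun x => ellNorm r fun k => f k x := by
  have hq0 : 0 < q := by linarith
  have hp : 1 < p := by linarith
  have hp0 : 0 < p := by linarith
  have hr0 : 0 < r := by linarith
  have hconj := Real.HolderConjugate.conjExponent hp
  have hp'1 : 1 < p.conjExponent := hconj.symm.lt
  have hpq : 1 < p / q := by rwa [one_lt_div hq0]
  have he : 1 / p.conjExponent = 1 - 1 / p := by rw [one_div, one_div, hconj.one_sub_inv]
  have h1p : 1 / p ≤ 1 := by rw [div_le_one hp0]; exact hp.le
  set A : ℝ≥0∞ := 2 * weakConst r D with hA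
  have hAt : A ≠ ⊤ := ENNReal.mul_ne_top (by simp) (weakConst_ne_top hr hDt)
  have hA1 : 1 ≤ A := by
    rw [hA, two_mul]
    exact (le_self_add : (1 : ℝ≥0∞) ≤ weakConst r D).trans le_self_add
  set L : ℝ≥0∞ := (2 * K) ^ q with hL
  have hLt : L ≠ ⊤ := ENNReal.rpow_ne_top_of_nonneg hq0.le (ENNReal.mul_ne_top (by simp) hKt)
  set c₁ : ℝ≥0∞ := doobConst (p / q) ^ (1 / p) with hc₁
  set c₂ : ℝ≥0∞ := doobConst p.conjExponent ^ (1 - 1 / p) with hc₂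
  have hc₁t : c₁ ≠ ⊤ := ENNReal.rpow_ne_top_of_nonneg (by positivity)
    (doobConst_ne_top (by positivity))
  have hc₂t : c₂ ≠ ⊤ := ENNReal.rpow_ne_top_of_nonneg (by linarith)
    (doobConst_ne_top (by linarith))
  refine ⟨A * (K * (L * (c₁ * c₂))), ENNReal.mul_ne_top hAt (ENNReal.mul_ne_top hKt
    (ENNReal.mul_ne_top hLt (ENNReal.mul_ne_top hc₁t hc₂t))), ?_⟩
  intro X ι _ _ G μ ν _ _ hK hμ hν hD f hf J lam hl0 hlt
  set F : X → ℝ≥0∞ := fun x => ellNorm r fun k => f k x with hF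
  have hFm : Measurable F := measurable_ellNorm hf r
  have hsparse : ∀ j ≤ J, ∀ x ∈ G.sel μ f r A j,
      ν (G.cell j x) ≤ L * ν (G.cell j x ∩ G.core μ f r A J j) := fun j hj x hx =>
    hK.measure_cell_le hq0 hμ ((measurableSet_cell j x).inter (measurableSet_core J j))
      inter_subset_left (measure_cell_le_two_mul (fun j x => (hμ j x).2) (fun j x => (hμ j x).1)
        hD1 hDt hD hf hr hA hAt hj hx)
  refine mul_rpow_le_of_forall_subset hp (measurableSet_lt measurable_const
    (Measurable.tsum fun k => (measurable_maxAvg 0 J (f k)).pow_const r)) hl0 hlt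
    fun Z hZ hZH hZt => ?_
  set E : ℝ → Set X := fun s => {y | ENNReal.ofReal s < F y} with hE
  have hEm : ∀ s, MeasurableSet (E s) := fun s => measurableSet_lt measurable_const hFm
  have hZm : Measurable (Z.indicator fun _ => (1 : ℝ≥0∞)) := measurable_const.indicator hZ
  have hpt : ∀ x ∈ Z, lam ≤ A * ∑ j ∈ Finset.range (J + 1),
      (G.sel μ f r A j).indicator (G.avg μ j F) x := by
    intro x hx
    have hx' : lam ^ r < ∑' k, G.maxAvg μ 0 J (f k) x ^ r := hZH hx
    rw [← ENNReal.rpow_le_rpow_iff hr0]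
    refine hx'.le.trans ((tsum_maxAvg_le_sum_sel hf hr hA1 J x).trans ?_)
    rw [Finset.mul_sum]
    refine le_trans (Finset.sum_le_sum fun j _ => ?_) (sum_rpow_le_rpow_sum _ _ hr.le)
    by_cases hxs : x ∈ G.sel μ f r A j
    · simp [hxs, hF]
    · simp [hxs]
  -- the contribution of one level set of `F`
  have hlevel : ∀ s : ℝ, ∑ j ∈ Finset.range (J + 1), ∫⁻ x in G.sel μ f r A j,
      G.avg μ j ((E s).indicator fun _ => 1) x * G.avg ν j (Z.indicator fun _ => 1) x ∂ν ≤
        K * (L * (c₁ * c₂)) * ν Z ^ (1 - 1 / p) * ν (E s) ^ (1 / p) := by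
    intro s
    set φ : ℕ → X → ℝ≥0∞ := fun j x => G.avg ν j ((E s).indicator fun _ => 1) x ^ (1 / q) *
      G.avg ν j (Z.indicator fun _ => 1) x with hφ
    have hφl : ∀ j, G.IsLevel j (φ j) := fun j x y h => by
      simp only [hφ, isLevel_avg j _ x y h]
    set mE := G.maxAvg ν 0 J ((E s).indicator fun _ => 1) with hmE
    set mZ := G.maxAvg ν 0 J (Z.indicator fun _ => 1) with hmZ
    have hmEm : Measurable mE := measurable_maxAvg 0 J _
    have hmZm : Measurable mZ := measurable_maxAvg 0 J _
    have hsum : ∑ j ∈ Finset.range (J + 1), ∫⁻ x in G.sel μ f r A j, φ j x ∂ν ≤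
        L * ∫⁻ x, mE x ^ (1 / q) * mZ x ∂ν := by
      refine sum_setLIntegral_sel_le hsparse hφl fun j hj x => ?_
      have hmem : j ∈ Finset.Icc 0 J := Finset.mem_Icc.2 ⟨Nat.zero_le j, hj⟩
      exact mul_le_mul' (ENNReal.rpow_le_rpow
        (Finset.le_sup (f := fun i => G.avg ν i ((E s).indicator fun _ => 1) x) hmem)
          (by positivity))
        (Finset.le_sup (f := fun i => G.avg ν i (Z.indicator fun _ => 1) x) hmem)
    have hholder : ∫⁻ x, mE x ^ (1 / q) * mZ x ∂ν ≤
        c₁ * ν (E s) ^ (1 / p) * (c₂ * ν Z ^ (1 - 1 / p)) := by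
      refine (ENNReal.lintegral_mul_le_Lp_mul_Lq ν hconj (hmEm.pow_const _).aemeasurable
        hmZm.aemeasurable).trans ?_
      rw [he, hc₁, hc₂, ← ENNReal.mul_rpow_of_nonneg _ _ (by positivity),
        ← ENNReal.mul_rpow_of_nonneg _ _ (by linarith)]
      refine mul_le_mul' (ENNReal.rpow_le_rpow ?_ (by positivity))
        (ENNReal.rpow_le_rpow ?_ (by linarith))
      · have : ∀ x, (mE x ^ (1 / q)) ^ p = mE x ^ (p / q) := by
          intro x
          rw [← ENNReal.rpow_mul, one_div_mul_eq_div]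
        simp_rw [this]
        exact maxAvg_indicator_rpow_le hν (hEm s) J hpq
      · exact maxAvg_indicator_rpow_le hν hZ J hp'1
    calc ∑ j ∈ Finset.range (J + 1), ∫⁻ x in G.sel μ f r A j,
          G.avg μ j ((E s).indicator fun _ => 1) x * G.avg ν j (Z.indicator fun _ => 1) x ∂ν
        ≤ ∑ j ∈ Finset.range (J + 1), K * ∫⁻ x in G.sel μ f r A j, φ j x ∂ν := by
          refine Finset.sum_le_sum fun j _ => ?_
          rw [← lintegral_const_mul _ (hφl j).measurable]
          refine lintegral_mono fun x => ?_
          rw [hφ, ← mul_assoc]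
          exact mul_le_mul_left (hK.avg_indicator_le hq0 hμ hν (hEm s) j x) _
      _ ≤ K * (L * (c₁ * ν (E s) ^ (1 / p) * (c₂ * ν Z ^ (1 - 1 / p)))) := by
          rw [← Finset.mul_sum]
          exact mul_le_mul_right (hsum.trans (mul_le_mul_right hholder _)) _
      _ = _ := by ring
  have hlevm : ∀ j, Measurable (Function.uncurry fun (x : X) (s : ℝ) =>
      G.avg μ j ((E s).indicator fun _ => 1) x * G.avg ν j (Z.indicator fun _ => 1) x) :=
    fun j => measurable_uncurry_of_level (G := G) (J := j)
      (fun s x y h => by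
        simp only [isLevel_avg j ((E s).indicator fun _ => 1) x y h, isLevel_avg j _ x y h])
      fun x => (measurable_avg_indicator_lt F j x).mul_const _
  -- the linear operator `F ↦ ∑ 1_{sel j} avg j F`, tested on `Z`
  have hdual : ∑ j ∈ Finset.range (J + 1), ∫⁻ x in G.sel μ f r A j,
      G.avg μ j F x * (Z.indicator fun _ => 1) x ∂ν ≤
        K * (L * (c₁ * c₂)) * ν Z ^ (1 - 1 / p) * lorentzOne ν p F := by
    calc ∑ j ∈ Finset.range (J + 1), ∫⁻ x in G.sel μ f r A j,
          G.avg μ j F x * (Z.indicator fun _ => 1) x ∂ν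
        = ∑ j ∈ Finset.range (J + 1), ∫⁻ s in Ioi (0 : ℝ), ∫⁻ x in G.sel μ f r A j,
            G.avg μ j ((E s).indicator fun _ => 1) x *
              G.avg ν j (Z.indicator fun _ => 1) x ∂ν := by
          refine Finset.sum_congr rfl fun j _ => ?_
          rw [← setLIntegral_mul_avg (fun j x => (hν j x).2)
            (fun x y h => mem_sel_of_idx_eq h) (isLevel_avg j F) hZm]
          rw [← lintegral_lintegral_swap (hlevm j).aemeasurable]
          refine lintegral_congr fun x => ?_
          rw [avg_eq_lintegral_avg_indicator hFm,
            lintegral_mul_const _ (measurable_avg_indicator_lt F j x)]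
      _ = ∫⁻ s in Ioi (0 : ℝ), ∑ j ∈ Finset.range (J + 1), ∫⁻ x in G.sel μ f r A j,
            G.avg μ j ((E s).indicator fun _ => 1) x *
              G.avg ν j (Z.indicator fun _ => 1) x ∂ν := by
          rw [lintegral_finsetSum]
          intro j _
          exact (hlevm j).lintegral_prod_left
      _ ≤ ∫⁻ s in Ioi (0 : ℝ),
            K * (L * (c₁ * c₂)) * ν Z ^ (1 - 1 / p) * ν (E s) ^ (1 / p) :=
          lintegral_mono hlevel
      _ = _ := by
          rw [lintegral_const_mul', lorentzOne]
          exact ENNReal.mul_ne_top (ENNReal.mul_ne_top hKt (ENNReal.mul_ne_top hLt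
            (ENNReal.mul_ne_top hc₁t hc₂t))) (ENNReal.rpow_ne_top_of_nonneg (by linarith) hZt)
  calc lam * ν Z = ∫⁻ _ in Z, lam ∂ν := by rw [setLIntegral_const]
    _ ≤ ∫⁻ x in Z, A * ∑ j ∈ Finset.range (J + 1),
          (G.sel μ f r A j).indicator (G.avg μ j F) x ∂ν := setLIntegral_mono' hZ hpt
    _ = A * ∑ j ∈ Finset.range (J + 1), ∫⁻ x in Z,
          (G.sel μ f r A j).indicator (G.avg μ j F) x ∂ν := by
        rw [lintegral_const_mul' _ _ hAt, lintegral_finsetSum _ fun j _ =>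
          (measurable_avg j F).indicator (measurableSet_sel j)]
    _ = A * ∑ j ∈ Finset.range (J + 1), ∫⁻ x in G.sel μ f r A j,
          G.avg μ j F x * (Z.indicator fun _ => 1) x ∂ν := by
        congr 1
        refine Finset.sum_congr rfl fun j _ => ?_
        rw [← lintegral_indicator hZ, ← lintegral_indicator (measurableSet_sel j)]
        refine lintegral_congr fun x => ?_
        by_cases h1 : x ∈ Z <;> by_cases h2 : x ∈ G.sel μ f r A j <;> simp [h1, h2]
    _ ≤ A * (K * (L * (c₁ * c₂)) * ν Z ^ (1 - 1 / p) * lorentzOne ν p F) :=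
        mul_le_mul_right hdual _
    _ = _ := by ring

end Grid

/-! ### Lorentz norms and distribution functions -/

section Lorentz

variable {X : Type*} [MeasurableSpace X] {ν : Measure X} {F : X → ℝ≥0∞}

lemma distribution_anti {s s' : ℝ≥0∞} (h : s ≤ s') :
    distribution ν F s' ≤ distribution ν F s :=
  measure_mono fun _ hx => h.trans_lt hx

lemma le_rearrangement {s t : ℝ≥0∞} (h : t < distribution ν F s) : s ≤ rearrangement ν F t := by
  refine le_sInf fun s' hs' => ?_
  by_contra hlt
  rw [not_le] at hlt
  exact absurd ((distribution_anti hlt.le).trans hs'.2) (not_le.2 h)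

lemma lorentzNorm_congr_ae {F' : X → ℝ≥0∞} (h : F =ᵐ[ν] F') (p q : ℝ≥0∞) :
    lorentzNorm ν p q F = lorentzNorm ν p q F' := by
  have hd : ∀ s, distribution ν F s = distribution ν F' s := by
    intro s
    refine measure_congr ?_
    filter_upwards [h] with x hx
    change (s < F x) = (s < F' x)
    rw [hx]
  have hr : ∀ t, rearrangement ν F t = rearrangement ν F' t := by
    intro t
    simp only [rearrangement, hd]
  simp only [lorentzNorm, hr]

/-- A bound on the weak norm from a bound on the distribution function. -/
lemma lorentzNorm_top_le {p B : ℝ≥0∞} (hp : 0 < (1 / p).toReal)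
    (h : ∀ lam : ℝ≥0∞, lam ≠ 0 → lam ≠ ⊤ →
      lam * ν {x | lam < F x} ^ (1 / p).toReal ≤ B) : lorentzNorm ν p ⊤ F ≤ B := by
  rw [lorentzNorm, if_pos rfl]
  refine iSup₂_le fun t ht => ?_
  set e := (1 / p).toReal
  rcases eq_or_ne B ⊤ with rfl | hB
  · exact le_top
  set T := ENNReal.ofReal t ^ e with hT
  have ht0 : ENNReal.ofReal t ≠ 0 := by simpa using ht
  have hT0 : T ≠ 0 := by simp [hT, ENNReal.rpow_eq_zero_iff, ht]
  have hTt : T ≠ ⊤ := ENNReal.rpow_ne_top_of_nonneg hp.le ENNReal.ofReal_ne_top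
  rw [mul_comm, ← ENNReal.le_div_iff_mul_le (Or.inl hT0) (Or.inl hTt)]
  refine le_of_forall_gt_imp_ge_of_dense fun s hs => ?_
  rcases eq_or_ne s ⊤ with rfl | hst
  · exact le_top
  have hs0 : 0 < s := (zero_le).trans_lt hs
  refine sInf_le ⟨hs0, ?_⟩
  have h1 := h s hs0.ne' hst
  rw [ENNReal.div_lt_iff (Or.inl hT0) (Or.inl hTt)] at hs
  have h2 := h1.trans_lt hs
  rw [ENNReal.mul_lt_mul_iff_right hs0.ne' hst] at h2
  exact ((ENNReal.rpow_lt_rpow_iff hp).1 h2).le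

lemma mul_rpow_le_lorentzNorm_top {p : ℝ≥0∞} (hp : 0 < (1 / p).toReal) {lam : ℝ≥0∞}
    (hlam : lam ≠ ⊤) : lam * ν {x | lam < F x} ^ (1 / p).toReal ≤ lorentzNorm ν p ⊤ F := by
  rw [lorentzNorm, if_pos rfl]
  set e := (1 / p).toReal
  set N := ⨆ t : ℝ, ⨆ _ : 0 < t, ENNReal.ofReal t ^ e * rearrangement ν F (ENNReal.ofReal t)
    with hN
  by_contra hcon
  rw [not_le] at hcon
  have hl0 : lam ≠ 0 := by
    rintro rfl
    simp at hcon
  rw [mul_comm, ← ENNReal.div_lt_iff (Or.inl hl0) (Or.inl hlam)] at hcon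
  have h1 : (N / lam) ^ (1 / e) < ν {x | lam < F x} := by
    have h2 := ENNReal.rpow_lt_rpow hcon (one_div_pos.2 hp)
    rwa [← ENNReal.rpow_mul, mul_one_div_cancel hp.ne', ENNReal.rpow_one] at h2
  obtain ⟨t, ht0, ht1, ht2⟩ := ENNReal.lt_iff_exists_real_btwn.1 h1
  have htpos : 0 < t := by
    by_contra h
    rw [ENNReal.ofReal_of_nonpos (not_lt.1 h)] at ht1
    exact not_lt_zero ht1
  have h3 : ENNReal.ofReal t ^ e * lam ≤ N :=
    (mul_le_mul_right (le_rearrangement ht2) _).trans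
      (le_iSup₂ (f := fun (t : ℝ) (_ : 0 < t) =>
        ENNReal.ofReal t ^ e * rearrangement ν F (ENNReal.ofReal t)) t htpos)
  refine absurd h3 (not_le.2 ?_)
  rw [← ENNReal.div_lt_iff (Or.inl hl0) (Or.inl hlam)]
  have h2 := ENNReal.rpow_lt_rpow ht1 hp
  rwa [← ENNReal.rpow_mul, one_div_mul_cancel hp.ne', ENNReal.rpow_one] at h2

lemma toReal_one_div_ofReal {p : ℝ} (hp : 0 < p) : (1 / ENNReal.ofReal p).toReal = 1 / p := by
  rw [ENNReal.toReal_div, ENNReal.toReal_one, ENNReal.toReal_ofReal hp.le]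

lemma toReal_one_div_conjExponent {p : ℝ} (hp : 1 < p) :
    (1 / (ENNReal.ofReal p).conjExponent).toReal = 1 - 1 / p := by
  have hp0 : 0 < p := by linarith
  have hp1 : 0 < p - 1 := by linarith
  have : (ENNReal.ofReal p).conjExponent = ENNReal.ofReal (1 + (p - 1)⁻¹) := by
    rw [ENNReal.conjExponent, ENNReal.ofReal_add one_pos.le (by positivity), ENNReal.ofReal_one,
      ENNReal.ofReal_inv_of_pos hp1, ENNReal.ofReal_sub _ one_pos.le, ENNReal.ofReal_one]
  rw [this, toReal_one_div_ofReal (by positivity)]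
  field_simp
  ring

lemma conjExponent_one : (1 : ℝ≥0∞).conjExponent = ⊤ := by
  simp [ENNReal.conjExponent]

lemma lorentzNorm_one_eq {p : ℝ} (hp : 0 < p) : lorentzNorm ν (ENNReal.ofReal p) 1 F =
    ∫⁻ t in Ioi (0 : ℝ), ENNReal.ofReal (1 / p * t ^ (1 / p - 1)) *
      rearrangement ν F (ENNReal.ofReal t) := by
  rw [lorentzNorm, if_neg ENNReal.one_ne_top, toReal_one_div_ofReal hp]
  simp only [div_one, ENNReal.toReal_one, ENNReal.rpow_one]
  rw [← lintegral_const_mul' _ _ (ENNReal.div_ne_top ENNReal.one_ne_top (by simpa using hp))]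
  refine setLIntegral_congr_fun measurableSet_Ioi fun t (ht : 0 < t) => ?_
  have h1 : 1 / ENNReal.ofReal p = ENNReal.ofReal (1 / p) := by
    rw [ENNReal.ofReal_div_of_pos hp, ENNReal.ofReal_one]
  rw [h1, ENNReal.ofReal_rpow_of_pos ht, ENNReal.mul_div_right_comm, ← mul_assoc,
    ← ENNReal.ofReal_div_of_pos ht, ← ENNReal.ofReal_mul (by positivity), Real.rpow_sub_one ht.ne']

/-- Half of the equality of the two expressions for the `L^{p,1}` norm, by Fubini for the region
under the graph of the distribution function. -/
lemma lorentzOne_le_lorentzNorm {p : ℝ} (hp : 0 < p) :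
    lorentzOne ν p F ≤ lorentzNorm ν (ENNReal.ofReal p) 1 F := by
  have hd : Measurable fun s : ℝ => ν {x | ENNReal.ofReal s < F x} :=
    Antitone.measurable fun s s' hss => measure_mono fun x hx =>
      (ENNReal.ofReal_le_ofReal hss).trans_lt hx
  have h := lintegral_weight_mul_meas_lt (ν := volume.restrict (Ioi (0 : ℝ))) hd
    (w := fun t => ENNReal.ofReal (1 / p * t ^ (1 / p - 1))) (by fun_prop)
    (g := fun _ => 1) measurable_const
  simp only [lintegral_one, Measure.restrict_apply_univ, one_mul,
    lintegral_indicator_rpow_weight (one_div_pos.2 hp)] at h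
  rw [lorentzOne, ← h, lorentzNorm_one_eq hp]
  refine lintegral_mono fun t => mul_le_mul_right ?_ _
  rw [Measure.restrict_apply (measurableSet_lt measurable_const hd)]
  set R := rearrangement ν F (ENNReal.ofReal t) with hR
  rcases eq_or_ne R ⊤ with hRt | hRt
  · rw [hRt]; exact le_top
  calc volume ({s : ℝ | ENNReal.ofReal t < ν {x | ENNReal.ofReal s < F x}} ∩ Ioi 0)
      ≤ volume (Ioc 0 R.toReal) := by
        refine measure_mono fun s hs => ⟨hs.2, ?_⟩
        have h1 : ENNReal.ofReal s ≤ R := le_rearrangement hs.1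
        rwa [ENNReal.ofReal_le_iff_le_toReal hRt] at h1
    _ = R := by rw [Real.volume_Ioc, sub_zero, ENNReal.ofReal_toReal hRt]

lemma lorentzNorm_indicator_le {p : ℝ} (hp : 0 < p) (E : Set X) :
    lorentzNorm ν (ENNReal.ofReal p) 1 (E.indicator fun _ => 1) ≤ ν E ^ (1 / p) := by
  rw [lorentzNorm_one_eq hp, ← lintegral_indicator_rpow_weight (one_div_pos.2 hp) (ν E)]
  refine lintegral_mono fun t => ?_
  by_cases ht : ENNReal.ofReal t < ν E
  · rw [indicator_of_mem (by exact ht)]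
    refine mul_le_of_le_one_right zero_le (sInf_le ⟨one_pos, ?_⟩)
    have : {x | 1 < E.indicator (fun _ => (1 : ℝ≥0∞)) x} = ∅ := by
      ext x
      by_cases hx : x ∈ E <;> simp [hx]
    rw [distribution, this, measure_empty]
    exact zero_le
  · have h0 : rearrangement ν (E.indicator fun _ => 1) (ENNReal.ofReal t) = 0 := by
      refine le_antisymm (le_of_forall_gt_imp_ge_of_dense fun s hs => ?_) zero_le
      refine sInf_le ⟨hs, (measure_mono fun x hx => ?_).trans (not_lt.1 ht)⟩
      have hx : s < E.indicator (fun _ => (1 : ℝ≥0∞)) x := hx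
      by_contra hxE
      rw [indicator_of_notMem hxE] at hx
      exact not_lt_zero hx
    rw [h0, mul_zero]
    exact zero_le

lemma rpow_le_lorentzNorm_indicator {p : ℝ} (hp : 0 < p) (E : Set X) :
    ν E ^ (1 / p) ≤ lorentzNorm ν (ENNReal.ofReal p) 1 (E.indicator fun _ => 1) := by
  rw [lorentzNorm_one_eq hp, ← lintegral_indicator_rpow_weight (one_div_pos.2 hp) (ν E)]
  refine lintegral_mono fun t => ?_
  by_cases ht : ENNReal.ofReal t < ν E
  · rw [indicator_of_mem (by exact ht)]
    refine le_mul_of_one_le_right zero_le ?_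
    refine le_of_forall_lt_imp_le_of_dense fun s hs => le_rearrangement (ht.trans_le ?_)
    refine measure_mono fun x hx => ?_
    change s < E.indicator (fun _ => (1 : ℝ≥0∞)) x
    rwa [indicator_of_mem hx]
  · rw [indicator_of_notMem (by exact ht)]
    exact zero_le

end Lorentz

/-! ### The class `A(p,1)` and the comparison of measures on cubes -/

section Cubes

variable {n : ℕ}

lemma cube_eq_pi (c : Fin n → ℝ) (h : ℝ) :
    cube c h = Set.pi univ fun i => Icc (c i - h) (c i + h) := by
  ext y
  simp only [cube, mem_pi, mem_univ, true_imp_iff, mem_Icc, mem_ofPred_eq, abs_le]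
  refine forall_congr' fun i => ?_
  constructor <;> rintro ⟨h1, h2⟩ <;> constructor <;> linarith

lemma measurableSet_cube (c : Fin n → ℝ) (h : ℝ) : MeasurableSet (cube c h) := by
  rw [cube_eq_pi]
  exact MeasurableSet.univ_pi fun i => measurableSet_Icc

lemma volume_cube (c : Fin n → ℝ) (h : ℝ) :
    volume (cube c h) = ENNReal.ofReal (2 * h) ^ n := by
  rw [cube_eq_pi, volume_pi_pi]
  simp only [Real.volume_Icc]
  rw [Finset.prod_congr rfl fun i _ => show ENNReal.ofReal (c i + h - (c i - h)) =
    ENNReal.ofReal (2 * h) by congr 1; ring]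
  simp

lemma volume_cube_ne_zero (c : Fin n → ℝ) {h : ℝ} (hh : 0 < h) : volume (cube c h) ≠ 0 := by
  rw [volume_cube]
  exact pow_ne_zero _ (by simpa using hh)

lemma volume_cube_ne_top (c : Fin n → ℝ) (h : ℝ) : volume (cube c h) ≠ ⊤ := by
  rw [volume_cube]
  exact ENNReal.pow_ne_top ENNReal.ofReal_ne_top

lemma isCompact_cube (c : Fin n → ℝ) (h : ℝ) : IsCompact (cube c h) := by
  rw [cube_eq_pi]
  exact isCompact_univ_pi fun i => isCompact_Icc

variable {ω : (Fin n → ℝ) → ℝ}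

/-- A weight may be replaced by a measurable density. -/
lemma IsWeight.exists_density (hω : IsWeight ω) : ∃ w : (Fin n → ℝ) → ℝ≥0∞, Measurable w ∧
    weightMeasure ω = volume.withDensity w ∧ (fun x => ENNReal.ofReal (ω x)) =ᵐ[volume] w := by
  have hm := hω.locallyIntegrable.aestronglyMeasurable.aemeasurable.ennreal_ofReal
  exact ⟨hm.mk _, hm.measurable_mk, withDensity_congr_ae hm.ae_eq_mk, hm.ae_eq_mk⟩

lemma weightMeasure_absolutelyContinuous (ω : (Fin n → ℝ) → ℝ) : weightMeasure ω ≪ volume :=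
  withDensity_absolutelyContinuous _ _

lemma IsWeight.volume_absolutelyContinuous (hω : IsWeight ω)
    (hpos : ∀ᵐ x ∂(volume : Measure (Fin n → ℝ)), 0 < ω x) : volume ≪ weightMeasure ω := by
  refine withDensity_absolutelyContinuous'
    hω.locallyIntegrable.aestronglyMeasurable.aemeasurable.ennreal_ofReal ?_
  filter_upwards [hpos] with x hx
  simpa using hx

lemma IsWeight.measure_cube_ne_top (hω : IsWeight ω) (c : Fin n → ℝ) (h : ℝ) :
    weightMeasure ω (cube c h) ≠ ⊤ := by
  rw [weightMeasure, withDensity_apply _ (measurableSet_cube c h)]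
  have hi := hω.locallyIntegrable.integrableOn_isCompact (isCompact_cube c h)
  refine ne_top_of_le_ne_top hi.2.ne (lintegral_mono fun x => ?_)
  exact Real.ofReal_le_enorm _

instance (ω : (Fin n → ℝ) → ℝ) : SigmaFinite (weightMeasure ω) :=
  SigmaFinite.withDensity_of_ne_top' fun _ => ENNReal.ofReal_ne_top

/-- Hölder's inequality in Lorentz spaces, for `E ⊆ Q` and the function `ω⁻¹`. -/
lemma volume_le_mul_lorentzNorm (hω : IsWeight ω)
    (hpos : ∀ᵐ x ∂(volume : Measure (Fin n → ℝ)), 0 < ω x) {p : ℝ} (hp : 1 < p)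
    {Q E : Set (Fin n → ℝ)} (hE : MeasurableSet E) (hEQ : E ⊆ Q) :
    volume E ≤ ENNReal.ofReal p * lorentzNorm (weightMeasure ω) (ENNReal.ofReal p).conjExponent ⊤
      (Q.indicator fun x => (ENNReal.ofReal (ω x))⁻¹) * weightMeasure ω E ^ (1 / p) := by
  have hp0 : 0 < p := by linarith
  have hp1 : 0 < 1 - 1 / p := by
    rw [sub_pos, div_lt_one hp0]; exact hp
  obtain ⟨w, hw, hνw, hae⟩ := hω.exists_density
  set ν := weightMeasure ω with hν
  set N := lorentzNorm ν (ENNReal.ofReal p).conjExponent ⊤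
    (Q.indicator fun x => (ENNReal.ofReal (ω x))⁻¹) with hN
  rcases eq_or_ne (ν E) 0 with h0 | h0
  · rw [hω.volume_absolutelyContinuous hpos h0]
    exact zero_le
  rcases eq_or_ne N ⊤ with hNt | hNt
  · have : ν E ^ (1 / p) ≠ 0 := by
      simp [ENNReal.rpow_eq_zero_iff, h0, hp0.le]
    rw [hNt, ENNReal.mul_top (by simpa using hp0), ENNReal.top_mul this]
    exact le_top
  have hwinv : Measurable fun x => (w x)⁻¹ := hw.inv
  have hvol : volume E = ∫⁻ x in E, (w x)⁻¹ ∂ν := by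
    rw [hνw, restrict_withDensity hE, lintegral_withDensity_eq_lintegral_mul _ hw hwinv,
      ← setLIntegral_one]
    refine lintegral_congr_ae (ae_restrict_of_ae ?_)
    filter_upwards [hae, hpos] with x hx hx0
    have h1 : w x ≠ 0 := by rw [← hx]; simpa using hx0
    have h2 : w x ≠ ⊤ := by rw [← hx]; exact ENNReal.ofReal_ne_top
    simp [ENNReal.mul_inv_cancel h1 h2]
  set d : ℝ → ℝ≥0∞ := fun s => ν.restrict E {x | ENNReal.ofReal s < (w x)⁻¹} with hd
  have hdm : Measurable d := Antitone.measurable fun s s' hss => measure_mono fun x hx =>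
    (ENNReal.ofReal_le_ofReal hss).trans_lt hx
  have hvol' : volume E = ∫⁻ s in Ioi (0 : ℝ), d s := by
    have h := lintegral_rpow_eq_lintegral_meas (ν := ν.restrict E) hwinv one_pos
    simpa [← hvol] using h
  have hdE : ∀ s, d s ≤ ν E := fun s =>
    (measure_mono (subset_univ _)).trans (by rw [Measure.restrict_apply_univ])
  have hdN : ∀ s, ENNReal.ofReal s * d s ^ (1 - 1 / p) ≤ N := by
    intro s
    have h := mul_rpow_le_lorentzNorm_top (ν := ν) (p := (ENNReal.ofReal p).conjExponent)
      (F := Q.indicator fun x => (ENNReal.ofReal (ω x))⁻¹)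
      (by rw [toReal_one_div_conjExponent hp]; exact hp1) (lam := ENNReal.ofReal s)
      ENNReal.ofReal_ne_top
    rw [toReal_one_div_conjExponent hp] at h
    refine (mul_le_mul_right (ENNReal.rpow_le_rpow ?_ hp1.le) _).trans h
    rw [hd]
    simp only
    rw [Measure.restrict_apply (measurableSet_lt measurable_const hwinv)]
    refine measure_mono_ae ?_
    filter_upwards [(weightMeasure_absolutelyContinuous ω).ae_eq hae] with x hx hxs
    change ENNReal.ofReal s < Q.indicator (fun x => (ENNReal.ofReal (ω x))⁻¹) x
    rw [indicator_of_mem (hEQ hxs.2), hx]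
    exact hxs.1
  -- integrate the distribution function along the other axis, where it becomes a power
  have hfub := lintegral_weight_mul_meas_lt (ν := volume.restrict (Ioi (0 : ℝ))) hdm
    (w := fun _ => 1) measurable_const (g := fun _ => 1) measurable_const
  have hone : ∀ a : ℝ≥0∞, ∫⁻ s in Ioi (0 : ℝ),
      {s : ℝ | ENNReal.ofReal s < a}.indicator (fun _ => 1) s = a := by
    intro a
    simpa using lintegral_indicator_rpow_weight one_pos a
  simp only [lintegral_one, Measure.restrict_apply_univ, one_mul, hone] at hfub
  rw [hvol', ← hfub, ← lintegral_indicator_rpow_weight (one_div_pos.2 hp0) (ν E),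
    ← lintegral_const_mul' _ _ (ENNReal.mul_ne_top ENNReal.ofReal_ne_top hNt)]
  refine setLIntegral_mono' measurableSet_Ioi fun t (ht : 0 < t) => ?_
  rw [Measure.restrict_apply (measurableSet_lt measurable_const hdm)]
  by_cases htE : ENNReal.ofReal t < ν E
  · rw [indicator_of_mem (by exact htE)]
    have hR : ENNReal.ofReal p * N * ENNReal.ofReal (1 / p * t ^ (1 / p - 1)) =
        ENNReal.ofReal (N.toReal * t ^ (1 / p - 1)) := by
      nth_rewrite 1 [← ENNReal.ofReal_toReal hNt]
      rw [← ENNReal.ofReal_mul hp0.le, ← ENNReal.ofReal_mul (by positivity)]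
      congr 1
      field_simp
    rw [hR]
    refine (measure_mono (t := Ioc 0 (N.toReal * t ^ (1 / p - 1))) fun s hs => ?_).trans_eq
      (by rw [Real.volume_Ioc, sub_zero])
    have hs0 : 0 < s := hs.2
    have hst : ENNReal.ofReal t < d s := hs.1
    refine ⟨hs0, ?_⟩
    have h1 : ENNReal.ofReal s * ENNReal.ofReal t ^ (1 - 1 / p) ≤ N :=
      (mul_le_mul_right (ENNReal.rpow_le_rpow hst.le hp1.le) _).trans (hdN s)
    rw [ENNReal.ofReal_rpow_of_pos ht, ← ENNReal.ofReal_mul hs0.le,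
      ENNReal.ofReal_le_iff_le_toReal hNt] at h1
    have h2 : t ^ (1 / p - 1) * t ^ (1 - 1 / p) = 1 := by
      rw [← Real.rpow_add ht]
      simp
    calc s = s * t ^ (1 - 1 / p) * t ^ (1 / p - 1) := by
          rw [mul_assoc, mul_comm (t ^ (1 - 1 / p)), h2, mul_one]
      _ ≤ _ := mul_le_mul_of_nonneg_right h1 (by positivity)
  · have : {s : ℝ | ENNReal.ofReal t < d s} = ∅ := by
      refine eq_empty_of_forall_notMem fun s hs => htE ?_
      exact lt_of_lt_of_le hs (hdE s)
    rw [this, empty_inter, measure_empty]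
    exact zero_le

/-- For positive weights, `A(p,1)` controls the Lebesgue density of a subset of a cube by its
weighted density. -/
lemma MemA.exists_comparable (hω : IsWeight ω)
    (hpos : ∀ᵐ x ∂(volume : Measure (Fin n → ℝ)), 0 < ω x) {p : ℝ} (hp : 1 < p)
    (hA : MemA (ENNReal.ofReal p) 1 ω) : ∃ K : ℝ≥0∞, K ≠ ⊤ ∧ ∀ (c : Fin n → ℝ) (h : ℝ), 0 < h →
      ∀ E, MeasurableSet E → E ⊆ cube c h →
        volume E * weightMeasure ω (cube c h) ^ (1 / p) ≤
          K * volume (cube c h) * weightMeasure ω E ^ (1 / p) := by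
  obtain ⟨C, -, hC⟩ := hA
  refine ⟨ENNReal.ofReal p * C, ENNReal.mul_ne_top ENNReal.ofReal_ne_top ENNReal.coe_ne_top, ?_⟩
  intro c h hh E hE hEQ
  have h1 := hC c h hh
  rw [conjExponent_one] at h1
  set N := lorentzNorm (weightMeasure ω) (ENNReal.ofReal p).conjExponent ⊤
    ((cube c h).indicator fun x => (ENNReal.ofReal (ω x))⁻¹)
  calc volume E * weightMeasure ω (cube c h) ^ (1 / p)
      ≤ ENNReal.ofReal p * N * weightMeasure ω E ^ (1 / p) *
          lorentzNorm (weightMeasure ω) (ENNReal.ofReal p) 1 ((cube c h).indicator fun _ => 1) :=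
        mul_le_mul' (volume_le_mul_lorentzNorm hω hpos hp hE hEQ)
          (rpow_le_lorentzNorm_indicator (by linarith) _)
    _ = ENNReal.ofReal p * weightMeasure ω E ^ (1 / p) *
          (lorentzNorm (weightMeasure ω) (ENNReal.ofReal p) 1
            ((cube c h).indicator fun _ => 1) * N) := by ring
    _ ≤ ENNReal.ofReal p * weightMeasure ω E ^ (1 / p) * (C * volume (cube c h)) :=
        mul_le_mul_right h1 _
    _ = _ := by ring

/-- Converse of `MemA.exists_comparable`: test on the sets where `ω⁻¹` is large. -/
lemma memA_of_comparable (hω : IsWeight ω) {p : ℝ} (hp : 1 < p) {K : ℝ≥0} (hK0 : 0 < K)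
    (hK : ∀ (c : Fin n → ℝ) (h : ℝ), 0 < h → ∀ E, MeasurableSet E → E ⊆ cube c h →
      volume E * weightMeasure ω (cube c h) ^ (1 / p) ≤
        K * volume (cube c h) * weightMeasure ω E ^ (1 / p)) :
    MemA (ENNReal.ofReal p) 1 ω := by
  have hp0 : 0 < p := by linarith
  have h1p : 0 < 1 / p := by positivity
  have hp1 : 0 < 1 - 1 / p := by
    rw [sub_pos, div_lt_one hp0]; exact hp
  obtain ⟨w, hw, hνw, hae⟩ := hω.exists_density
  refine ⟨K, hK0, fun c h hh => ?_⟩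
  rw [conjExponent_one]
  set ν := weightMeasure ω with hν
  set Q := cube c h with hQ
  have hnorm := lorentzNorm_indicator_le (ν := ν) hp0 Q
  rcases eq_or_ne (ν Q) 0 with h0 | h0
  · rw [h0, ENNReal.zero_rpow_of_pos h1p] at hnorm
    rw [le_antisymm hnorm zero_le, zero_mul]
    exact zero_le
  have hQ0 : ν Q ^ (1 / p) ≠ 0 := by simp [ENNReal.rpow_eq_zero_iff, h0, hp0.le]
  have hQt : ν Q ^ (1 / p) ≠ ⊤ :=
    ENNReal.rpow_ne_top_of_nonneg h1p.le (hω.measure_cube_ne_top c h)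
  suffices hN : lorentzNorm ν (ENNReal.ofReal p).conjExponent ⊤
      (Q.indicator fun x => (ENNReal.ofReal (ω x))⁻¹) ≤ K * volume Q / ν Q ^ (1 / p) by
    refine (mul_le_mul' hnorm hN).trans_eq ?_
    exact ENNReal.mul_div_cancel hQ0 hQt
  have hcongr : (Q.indicator fun x => (ENNReal.ofReal (ω x))⁻¹) =ᵐ[ν]
      Q.indicator fun x => (w x)⁻¹ := by
    filter_upwards [(weightMeasure_absolutelyContinuous ω).ae_eq hae] with x hx
    by_cases hxQ : x ∈ Q
    · rw [indicator_of_mem hxQ, indicator_of_mem hxQ, hx]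
    · rw [indicator_of_notMem hxQ, indicator_of_notMem hxQ]
  rw [lorentzNorm_congr_ae hcongr]
  refine lorentzNorm_top_le (by rw [toReal_one_div_conjExponent hp]; exact hp1)
    fun lam hl0 hlt => ?_
  rw [toReal_one_div_conjExponent hp]
  have hQm : MeasurableSet Q := measurableSet_cube c h
  set E := {x | lam < Q.indicator (fun x => (w x)⁻¹) x} with hE
  have hEm : MeasurableSet E := measurableSet_lt measurable_const (hw.inv.indicator hQm)
  have hEQ : E ⊆ Q := by
    intro x (hx : lam < Q.indicator (fun x => (w x)⁻¹) x)
    by_contra hxQ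
    rw [indicator_of_notMem hxQ] at hx
    exact not_lt_zero hx
  rcases eq_or_ne (ν E) 0 with hE0 | hE0
  · rw [hE0, ENNReal.zero_rpow_of_pos hp1, mul_zero]
    exact zero_le
  have hEt : ν E ≠ ⊤ := ne_top_of_le_ne_top (hω.measure_cube_ne_top c h) (measure_mono hEQ)
  have hE0' : ν E ^ (1 / p) ≠ 0 := by simp [ENNReal.rpow_eq_zero_iff, hE0, hp0.le]
  have hEt' : ν E ^ (1 / p) ≠ ⊤ := ENNReal.rpow_ne_top_of_nonneg h1p.le hEt
  have hle : lam * ν E ≤ volume E := by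
    rw [hνw, withDensity_apply _ hEm, ← lintegral_const_mul _ hw, ← setLIntegral_one]
    refine setLIntegral_mono' hEm fun x hx => ?_
    have hx' : lam < Q.indicator (fun x => (w x)⁻¹) x := hx
    rw [indicator_of_mem (hEQ hx)] at hx'
    exact (mul_le_mul_left hx'.le _).trans (ENNReal.inv_mul_le_one _)
  rw [ENNReal.le_div_iff_mul_le (Or.inl hQ0) (Or.inl hQt),
    ← ENNReal.mul_le_mul_iff_left hE0' hEt']
  have hsplit : ν E ^ (1 - 1 / p) * ν E ^ (1 / p) = ν E := by
    rw [← ENNReal.rpow_add _ _ hE0 hEt, sub_add_cancel, ENNReal.rpow_one]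
  calc lam * ν E ^ (1 - 1 / p) * ν Q ^ (1 / p) * ν E ^ (1 / p)
      = lam * (ν E ^ (1 - 1 / p) * ν E ^ (1 / p)) * ν Q ^ (1 / p) := by ring
    _ ≤ volume E * ν Q ^ (1 / p) := by
        rw [hsplit]
        exact mul_le_mul_left hle _
    _ ≤ _ := hK c h hh E hEm hEQ

/-! ### Necessity of `A(p,1)` -/

lemma ellNorm_single {r : ℝ} (hr : 0 < r) {a : ℕ → ℝ≥0∞} (ha : ∀ k, k ≠ 0 → a k = 0) :
    ellNorm r a = a 0 := by
  rw [ellNorm, tsum_eq_single 0 fun k hk => by rw [ha k hk, ENNReal.zero_rpow_of_pos hr],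
    ← ENNReal.rpow_mul, mul_one_div_cancel hr.ne', ENNReal.rpow_one]

theorem memA_of_maximalBounded (hω : IsWeight ω) {p r : ℝ} (hp : 1 < p) (hr : 1 < r)
    (hM : MaximalBounded (ENNReal.ofReal p) r ω) : MemA (ENNReal.ofReal p) 1 ω := by
  have hp0 : 0 < p := by linarith
  have hr0 : 0 < r := by linarith
  have h1p : 0 < 1 / p := by positivity
  obtain ⟨C, hC0, hC⟩ := hM
  refine memA_of_comparable hω hp (K := 2 ^ n * C) (by positivity) fun c h hh E hE hEQ => ?_
  set ν := weightMeasure ω with hν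
  -- the test sequence `(χ_E, 0, 0, …)`
  set f : ℕ → (Fin n → ℝ) → ℂ := fun k => if k = 0 then E.indicator (fun _ => 1) else 0 with hf
  have hf0 : ∀ y, ‖f 0 y‖ₑ = E.indicator (fun _ => 1) y := by
    intro y
    by_cases hy : y ∈ E <;> simp [hf, hy]
  have hfell : (fun x => ellNorm r fun k => ‖f k x‖ₑ) = E.indicator fun _ => 1 := by
    funext x
    rw [ellNorm_single hr0 fun k hk => by simp [hf, hk], hf0]
  have hnorm : vectorLorentzNorm (ENNReal.ofReal p) 1 r ω f ≤ ν E ^ (1 / p) := by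
    rw [vectorLorentzNorm, hfell]
    exact lorentzNorm_indicator_le hp0 E
  have hEt : ν E ≠ ⊤ := ne_top_of_le_ne_top (hω.measure_cube_ne_top c h) (measure_mono hEQ)
  have hmem : MemVectorLorentz (ENNReal.ofReal p) 1 r ω f := by
    refine ⟨fun k => ?_, hnorm.trans_lt (ENNReal.rpow_lt_top_of_nonneg h1p.le hEt)⟩
    by_cases hk : k = 0
    · simp only [hf, hk, if_true]
      exact (measurable_const.indicator hE).aemeasurable
    · simp only [hf, hk, if_false]
      exact aemeasurable_const
  have hvol2 : ∀ x : Fin n → ℝ, volume (cube x (2 * h)) = 2 ^ n * volume (cube c h) := by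
    intro x
    rw [volume_cube, volume_cube, ← mul_pow]
    congr 1
    rw [ENNReal.ofReal_mul two_pos.le (q := 2 * h), ENNReal.ofReal_ofNat]
  set m := (2 ^ n * volume (cube c h))⁻¹ * volume E with hm
  have hmax : ∀ x ∈ cube c h, m ≤ ellNorm r fun k => maximal (f k) x := by
    intro x hx
    refine le_trans ?_ (le_ellNorm hr0 (fun k => maximal (f k) x) 0)
    refine le_trans ?_ (le_iSup₂ (f := fun (h : ℝ) (_ : 0 < h) =>
      (volume (cube x h))⁻¹ * ∫⁻ y in cube x h, ‖f 0 y‖ₑ) (2 * h) (by positivity))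
    have hsub : E ⊆ cube x (2 * h) := by
      intro y hy i
      have h1 : |y i - c i| ≤ h := hEQ hy i
      have h2 : |x i - c i| ≤ h := hx i
      rw [abs_le] at h1 h2 ⊢
      constructor <;> linarith
    simp only [hf0]
    rw [hvol2, lintegral_indicator hE, lintegral_one, Measure.restrict_apply_univ,
      Measure.restrict_apply hE, inter_eq_left.2 hsub]
  have hweak : m * ν (cube c h) ^ (1 / p) ≤ C * ν E ^ (1 / p) := by
    refine ENNReal.mul_le_of_forall_lt fun lam hlam b hb => ?_
    have h1 := mul_rpow_le_lorentzNorm_top (ν := ν) (p := ENNReal.ofReal p)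
      (F := fun x => ellNorm r fun k => maximal (f k) x) (lam := lam)
      (by rw [toReal_one_div_ofReal hp0]; exact h1p) (ne_top_of_lt hlam)
    rw [toReal_one_div_ofReal hp0] at h1
    calc lam * b ≤ lam * ν {x | lam < ellNorm r fun k => maximal (f k) x} ^ (1 / p) := by
          refine mul_le_mul_right (hb.le.trans (ENNReal.rpow_le_rpow (measure_mono ?_) h1p.le)) _
          exact fun x hx => hlam.trans_le (hmax x hx)
      _ ≤ C * vectorLorentzNorm (ENNReal.ofReal p) 1 r ω f := h1.trans (hC f hmem)
      _ ≤ C * ν E ^ (1 / p) := mul_le_mul_right hnorm _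
  have hV0 : 2 ^ n * volume (cube c h) ≠ 0 :=
    mul_ne_zero (by simp) (volume_cube_ne_zero c hh)
  have hVt : 2 ^ n * volume (cube c h) ≠ ⊤ :=
    ENNReal.mul_ne_top (by simp) (volume_cube_ne_top c h)
  calc volume E * ν (cube c h) ^ (1 / p)
      = 2 ^ n * volume (cube c h) * (m * ν (cube c h) ^ (1 / p)) := by
        rw [hm, ← mul_assoc, ← mul_assoc, ENNReal.mul_inv_cancel hV0 hVt, one_mul]
    _ ≤ 2 ^ n * volume (cube c h) * (C * ν E ^ (1 / p)) := mul_le_mul_right hweak _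
    _ = _ := by push_cast; ring

end Cubes

/-! ### Shifted dyadic grids -/

section Dyadic

variable {n : ℕ}

lemma floor_half_eq {a b : ℝ} (h : ⌊a⌋ = ⌊b⌋) : ⌊a / 2⌋ = ⌊b / 2⌋ := by
  have key : ∀ a b : ℝ, ⌊a⌋ = ⌊b⌋ → ⌊a / 2⌋ ≤ ⌊b / 2⌋ := by
    intro a b h
    rw [Int.le_floor]
    have h1 : (⌊a / 2⌋ : ℝ) ≤ a / 2 := Int.floor_le _
    have h2 : 2 * ⌊a / 2⌋ ≤ ⌊b⌋ := by
      rw [← h, Int.le_floor]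
      push_cast
      linarith
    have h3 : (2 * ⌊a / 2⌋ : ℝ) ≤ b := by
      have := Int.le_floor.1 h2
      push_cast at this
      exact this
    linarith
  exact le_antisymm (key a b h) (key b a h.symm)

/-- The side length of the cells of level `j` of a grid with top scale `2 ^ N`. -/
def side (N j : ℕ) : ℝ := 2 ^ N / 2 ^ j

lemma side_pos (N j : ℕ) : 0 < side N j := by unfold side; positivity

lemma side_succ (N j : ℕ) : side N j = 2 * side N (j + 1) := by
  unfold side
  field_simp
  ring

/-- The dyadic grid translated by `τ`, with cells of side `2 ^ N` at level `0`. -/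
def dyadicGrid (N : ℕ) (τ : Fin n → ℝ) : Grid (Fin n → ℝ) (Fin n → ℤ) where
  idx j x i := ⌊(x i - τ i) / side N j⌋
  measurableSet_fiber j m := by
    have : Measurable fun (x : Fin n → ℝ) (i : Fin n) => ⌊(x i - τ i) / side N j⌋ :=
      measurable_pi_lambda _ fun i => by fun_prop
    exact this (measurableSet_singleton m)
  nested j x y h := by
    funext i
    have hi := congrFun h i
    have hs : ∀ a : ℝ, a / side N j = a / side N (j + 1) / 2 := by
      intro a
      rw [side_succ N j, div_div, mul_comm]
    simp only [hs]
    exact floor_half_eq hi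

/-- The lower corner of the cell of level `j` that contains `x`. -/
def corner (N : ℕ) (τ : Fin n → ℝ) (j : ℕ) (x : Fin n → ℝ) (i : Fin n) : ℝ :=
  τ i + side N j * ⌊(x i - τ i) / side N j⌋

lemma cell_dyadicGrid (N : ℕ) (τ : Fin n → ℝ) (j : ℕ) (x : Fin n → ℝ) :
    (dyadicGrid N τ).cell j x =
      Set.pi univ fun i => Ico (corner N τ j x i) (corner N τ j x i + side N j) := by
  have hs := side_pos N j
  ext y
  simp only [Grid.cell, dyadicGrid, mem_ofPred_eq, mem_pi, mem_univ, true_imp_iff, mem_Ico,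
    funext_iff, corner]
  refine forall_congr' fun i => ?_
  rw [Int.floor_eq_iff, le_div_iff₀ hs, div_lt_iff₀ hs]
  constructor <;> rintro ⟨h1, h2⟩ <;> constructor <;> nlinarith

lemma volume_cell_dyadicGrid (N : ℕ) (τ : Fin n → ℝ) (j : ℕ) (x : Fin n → ℝ) :
    volume ((dyadicGrid N τ).cell j x) = ENNReal.ofReal (side N j) ^ n := by
  rw [cell_dyadicGrid, volume_pi_pi]
  simp

lemma charged_volume_dyadicGrid (N : ℕ) (τ : Fin n → ℝ) : (dyadicGrid N τ).Charged volume := by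
  intro j x
  rw [volume_cell_dyadicGrid]
  exact ⟨pow_ne_zero _ (by simpa using side_pos N j), ENNReal.pow_ne_top ENNReal.ofReal_ne_top⟩

lemma volume_cell_le_dyadicGrid (N : ℕ) (τ : Fin n → ℝ) (j : ℕ) (x : Fin n → ℝ) :
    volume ((dyadicGrid N τ).cell j x) ≤ 2 ^ n * volume ((dyadicGrid N τ).cell (j + 1) x) := by
  rw [volume_cell_dyadicGrid, volume_cell_dyadicGrid, ← mul_pow, side_succ N j,
    ENNReal.ofReal_mul two_pos.le, ENNReal.ofReal_ofNat]

/-- A cell lies in a closed cube of the same volume. -/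
lemma exists_cube_cell (N : ℕ) (τ : Fin n → ℝ) (j : ℕ) (x : Fin n → ℝ) :
    ∃ c, (dyadicGrid N τ).cell j x ⊆ cube c (side N j / 2) ∧
      volume (cube c (side N j / 2)) = volume ((dyadicGrid N τ).cell j x) := by
  refine ⟨fun i => corner N τ j x i + side N j / 2, ?_, ?_⟩
  · rw [cell_dyadicGrid, cube_eq_pi]
    refine Set.pi_mono fun i _ y hy => ⟨?_, ?_⟩
    · have := hy.1; linarith
    · have := hy.2; linarith
  · rw [volume_cube, volume_cell_dyadicGrid, mul_div_cancel₀ _ (two_ne_zero)]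

/-- The translations by a third of the top scale, in an arbitrary set of coordinates. -/
def thirdShift (N : ℕ) (S : Finset (Fin n)) (i : Fin n) : ℝ := if i ∈ S then 2 ^ N / 3 else 0

/-- The one-third trick on the line: an interval `[a, b]` shorter than `1 / 3` cannot meet both
the integers and their translate by `2 ^ j / 3`. -/
lemma floor_sub_third_eq {a b : ℝ} (hab : a ≤ b) (hlt : b - a < 1 / 3) (h : ⌊a⌋ ≠ ⌊b⌋) (j : ℕ) :
    ⌊a - 2 ^ j / 3⌋ = ⌊b - 2 ^ j / 3⌋ := by
  have key : ∀ u v : ℝ, u ≤ v → ⌊u⌋ ≠ ⌊v⌋ → u < ⌊v⌋ := by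
    intro u v huv hne
    have h1 := lt_of_le_of_ne (Int.floor_le_floor huv) hne
    exact Int.floor_lt.1 h1
  by_contra hne
  have h1 := key a b hab h
  have h2 := key _ _ (sub_le_sub_right hab _) hne
  have h3 : (⌊b⌋ : ℝ) ≤ b := Int.floor_le _
  have h4 : (⌊b - 2 ^ j / 3⌋ : ℝ) ≤ b - 2 ^ j / 3 := Int.floor_le _
  set m := ⌊b⌋
  set m' := ⌊b - 2 ^ j / 3⌋
  have h5 : (3 * (m - m') - 2 ^ j : ℝ) < 1 := by linarith
  have h6 : (-1 : ℝ) < 3 * (m - m') - 2 ^ j := by linarith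
  have h5' : 3 * (m - m') - 2 ^ j < 1 := by exact_mod_cast h5
  have h6' : -1 < 3 * (m - m') - 2 ^ j := by exact_mod_cast h6
  have h7 : (3 : ℤ) ∣ 2 ^ j := ⟨m - m', by omega⟩
  have h8 := Int.Prime.dvd_pow' (by norm_num : Nat.Prime 3) h7
  omega

/-- A small centred cube lies in a cell of one of finitely many translated grids. -/
lemma exists_cube_subset_cell {N j : ℕ} (x : Fin n → ℝ) {h : ℝ} (hh : 0 < h)
    (hj : 12 * h ≤ side N j) :
    ∃ S : Finset (Fin n), cube x h ⊆ (dyadicGrid N (thirdShift N S)).cell j x := by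
  classical
  have hs := side_pos N j
  refine ⟨Finset.univ.filter fun i => ⌊(x i - h) / side N j⌋ ≠ ⌊(x i + h) / side N j⌋, ?_⟩
  set S := Finset.univ.filter fun i => ⌊(x i - h) / side N j⌋ ≠ ⌊(x i + h) / side N j⌋ with hS
  have hends : ∀ i, ⌊(x i - h - thirdShift N S i) / side N j⌋ =
      ⌊(x i + h - thirdShift N S i) / side N j⌋ := by
    intro i
    by_cases hi : i ∈ S
    · have hne : ⌊(x i - h) / side N j⌋ ≠ ⌊(x i + h) / side N j⌋ := by
        simpa [hS] using hi
      have hq : (2 : ℝ) ^ N / 3 / side N j = 2 ^ j / 3 := by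
        unfold side
        field_simp
      simp only [thirdShift, hi, if_true, sub_div, add_sub_assoc, add_div, hq]
      rw [sub_div, add_div] at hne
      have hsmall : h / side N j ≤ 1 / 12 := by
        rw [div_le_iff₀ hs]; linarith
      have hpos : 0 ≤ h / side N j := by positivity
      have := floor_sub_third_eq (a := x i / side N j - h / side N j)
        (b := x i / side N j + h / side N j) (by linarith) (by linarith) hne j
      rw [this, add_sub_assoc]
    · have heq : ⌊(x i - h) / side N j⌋ = ⌊(x i + h) / side N j⌋ := by
        simpa [hS] using hi
      simpa [thirdShift, hi] using heq
  have hmid : ∀ i (y : ℝ), |y - x i| ≤ h → ⌊(y - thirdShift N S i) / side N j⌋ =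
      ⌊(x i - h - thirdShift N S i) / side N j⌋ := by
    intro i y hy
    rw [abs_le] at hy
    refine le_antisymm ?_ (Int.floor_le_floor ?_)
    · rw [hends]
      refine Int.floor_le_floor ?_
      gcongr
      linarith
    · gcongr
      linarith
  intro y hy
  change (dyadicGrid N (thirdShift N S)).idx j y = (dyadicGrid N (thirdShift N S)).idx j x
  funext i
  change ⌊(y i - thirdShift N S i) / side N j⌋ = ⌊(x i - thirdShift N S i) / side N j⌋
  rw [hmid i (y i) (hy i), hmid i (x i) (by simpa using hh.le)]

/-! ### From the grids to the maximal function -/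

/-- The maximal function over centred cubes whose size is comparable to the scales of the grids
with parameter `N`. -/
def truncMaximal (N : ℕ) (g : (Fin n → ℝ) → ℝ≥0∞) (x : Fin n → ℝ) : ℝ≥0∞ :=
  ⨆ h : ℝ, ⨆ _ : 0 < h ∧ 12 * h ≤ 2 ^ N ∧ 1 ≤ 12 * h * 2 ^ N,
    (volume (cube x h))⁻¹ * ∫⁻ y in cube x h, g y

lemma truncMaximal_mono (g : (Fin n → ℝ) → ℝ≥0∞) (x : Fin n → ℝ) :
    Monotone fun N => truncMaximal N g x := by
  intro N N' hN
  refine iSup_mono fun h => iSup_mono' fun hc => ⟨⟨hc.1, hc.2.1.trans ?_, hc.2.2.trans ?_⟩, le_rfl⟩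
  · gcongr
    norm_num
  · have := hc.1
    gcongr
    norm_num

lemma iSup_truncMaximal (g : (Fin n → ℝ) → ℝ≥0∞) (x : Fin n → ℝ) :
    ⨆ N, truncMaximal N g x =
      ⨆ h : ℝ, ⨆ _ : 0 < h, (volume (cube x h))⁻¹ * ∫⁻ y in cube x h, g y := by
  refine le_antisymm (iSup_le fun N => iSup_mono fun h => iSup_mono' fun hc => ⟨hc.1, le_rfl⟩)
    (iSup₂_le fun h hh => ?_)
  obtain ⟨N₁, h₁⟩ := pow_unbounded_of_one_lt (12 * h) (one_lt_two : (1 : ℝ) < 2)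
  obtain ⟨N₂, h₂⟩ := pow_unbounded_of_one_lt (12 * h)⁻¹ (one_lt_two : (1 : ℝ) < 2)
  have e₁ : (2 : ℝ) ^ N₁ ≤ 2 ^ (max N₁ N₂) := pow_le_pow_right₀ (by norm_num) (le_max_left _ _)
  have e₂ : (2 : ℝ) ^ N₂ ≤ 2 ^ (max N₁ N₂) := pow_le_pow_right₀ (by norm_num) (le_max_right _ _)
  refine le_iSup_of_le (max N₁ N₂) (le_iSup_of_le h (le_iSup_of_le
    ⟨hh, h₁.le.trans e₁, ?_⟩ le_rfl))
  rw [inv_lt_iff_one_lt_mul₀ (by positivity)] at h₂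
  have : 12 * h * 2 ^ N₂ ≤ 12 * h * 2 ^ (max N₁ N₂) := by gcongr
  linarith

lemma truncMaximal_rpow_le {r : ℝ} (hr : 0 < r) (N : ℕ) (g : (Fin n → ℝ) → ℝ≥0∞)
    (x : Fin n → ℝ) : truncMaximal N g x ^ r ≤ ∑ S : Finset (Fin n),
      (12 ^ n * (dyadicGrid N (thirdShift N S)).maxAvg volume 0 (2 * N) g x) ^ r := by
  suffices h : truncMaximal N g x ≤ (∑ S : Finset (Fin n),
      (12 ^ n * (dyadicGrid N (thirdShift N S)).maxAvg volume 0 (2 * N) g x) ^ r) ^ (1 / r) by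
    refine (ENNReal.rpow_le_rpow h hr.le).trans_eq ?_
    rw [← ENNReal.rpow_mul, one_div_mul_cancel hr.ne', ENNReal.rpow_one]
  refine iSup₂_le fun h ⟨hh, h1, h2⟩ => ?_
  -- the level whose side lies in `[12 h, 24 h)`
  obtain ⟨j, hj1, hj2⟩ := exists_nat_pow_near (x := 2 ^ N / (12 * h)) (y := (2 : ℝ))
    (by rwa [one_le_div (by positivity)]) one_lt_two
  rw [le_div_iff₀ (by positivity)] at hj1
  rw [div_lt_iff₀ (by positivity)] at hj2
  have hside1 : 12 * h ≤ side N j := by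
    rw [side, le_div_iff₀ (by positivity)]; linarith
  have hside2 : side N j ≤ 24 * h := by
    rw [side, div_le_iff₀ (by positivity)]
    rw [pow_succ] at hj2
    linarith
  have hjN : j ≤ 2 * N := by
    by_contra hcon
    rw [not_le] at hcon
    have h3 : (2 : ℝ) ^ (2 * N + 1) ≤ 2 ^ j := pow_le_pow_right₀ (by norm_num) hcon
    have h4 : (2 : ℝ) ^ (2 * N + 1) * (12 * h) ≤ 2 ^ N :=
      (mul_le_mul_of_nonneg_right h3 (by positivity)).trans hj1
    have h5 : (2 : ℝ) ^ (2 * N + 1) * (12 * h) = 2 ^ N * (2 * (12 * h * 2 ^ N)) := by ring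
    have h6 : (0 : ℝ) < 2 ^ N := by positivity
    nlinarith
  obtain ⟨S, hS⟩ := exists_cube_subset_cell (N := N) (j := j) x hh hside1
  set G := dyadicGrid N (thirdShift N S) with hG
  have hvol : volume (G.cell j x) ≤ 12 ^ n * volume (cube x h) := by
    rw [hG, volume_cell_dyadicGrid, volume_cube, ← mul_pow]
    refine pow_le_pow_left' ?_ n
    rw [← ENNReal.ofReal_ofNat, ← ENNReal.ofReal_mul (by norm_num)]
    exact ENNReal.ofReal_le_ofReal (by linarith)
  have havg : (volume (cube x h))⁻¹ * ∫⁻ y in cube x h, g y ≤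
      12 ^ n * G.maxAvg volume 0 (2 * N) g x := by
    have h3 : (volume (cube x h))⁻¹ ≤ 12 ^ n * (volume (G.cell j x))⁻¹ := by
      calc (volume (cube x h))⁻¹ = 12 ^ n * (12 ^ n * volume (cube x h))⁻¹ := by
            rw [ENNReal.mul_inv (Or.inl (by simp)) (Or.inl (by simp)), ← mul_assoc,
              ENNReal.mul_inv_cancel (by simp) (by simp), one_mul]
        _ ≤ _ := mul_le_mul_right (ENNReal.inv_le_inv.2 hvol) _
    refine (mul_le_mul' h3 (lintegral_mono_set hS)).trans ?_
    rw [mul_assoc]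
    exact mul_le_mul_right (Finset.le_sup (f := fun i => G.avg volume i g x)
      (Finset.mem_Icc.2 ⟨Nat.zero_le j, hjN⟩)) _
  refine havg.trans ?_
  rw [← ENNReal.rpow_le_rpow_iff hr, ← ENNReal.rpow_mul, one_div_mul_cancel hr.ne',
    ENNReal.rpow_one]
  exact Finset.single_le_sum (f := fun S : Finset (Fin n) =>
    (12 ^ n * (dyadicGrid N (thirdShift N S)).maxAvg volume 0 (2 * N) g x) ^ r)
    (fun _ _ => zero_le) (Finset.mem_univ S)

variable {ω : (Fin n → ℝ) → ℝ}

lemma charged_weightMeasure_dyadicGrid (hω : IsWeight ω)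
    (hpos : ∀ᵐ x ∂(volume : Measure (Fin n → ℝ)), 0 < ω x) (N : ℕ) (τ : Fin n → ℝ) :
    (dyadicGrid N τ).Charged (weightMeasure ω) := by
  intro j x
  refine ⟨fun h => (charged_volume_dyadicGrid N τ j x).1
    (hω.volume_absolutelyContinuous hpos h), ?_⟩
  obtain ⟨c, hc, -⟩ := exists_cube_cell N τ j x
  exact ne_top_of_le_ne_top (hω.measure_cube_ne_top c _) (measure_mono hc)

lemma MemA.exists_comparable_dyadicGrid (hω : IsWeight ω)
    (hpos : ∀ᵐ x ∂(volume : Measure (Fin n → ℝ)), 0 < ω x) {p : ℝ} (hp : 1 < p)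
    (hA : MemA (ENNReal.ofReal p) 1 ω) : ∃ K : ℝ≥0∞, K ≠ ⊤ ∧ ∀ (N : ℕ) (τ : Fin n → ℝ),
      (dyadicGrid N τ).Comparable volume (weightMeasure ω) p K := by
  obtain ⟨K, hKt, hK⟩ := hA.exists_comparable hω hpos hp
  refine ⟨K, hKt, fun N τ j x E hE hsub => ?_⟩
  obtain ⟨c, hc, hvol⟩ := exists_cube_cell N τ j x
  have h := hK c (side N j / 2) (by have := side_pos N j; positivity) E hE (hsub.trans hc)
  rw [hvol] at h
  refine le_trans (mul_le_mul_right (ENNReal.rpow_le_rpow (measure_mono hc) ?_) _) h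
  have : 0 < p := by linarith
  positivity

/-- Weak-type bounds that are uniform over the translated grids give the boundedness of the
maximal operator. -/
lemma maximalBounded_of_grid {p r : ℝ} (hp : 1 < p) (hr : 1 < r) {C : ℝ≥0∞} (hCt : C ≠ ⊤)
    (hC : ∀ (N : ℕ) (τ : Fin n → ℝ) (g : ℕ → (Fin n → ℝ) → ℝ≥0∞), (∀ k, Measurable (g k)) →
      ∀ (J : ℕ) (lam : ℝ≥0∞), lam ≠ 0 → lam ≠ ⊤ →
        lam * weightMeasure ω {x | lam ^ r <
          ∑' k, (dyadicGrid N τ).maxAvg volume 0 J (g k) x ^ r} ^ (1 / p) ≤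
            C * lorentzOne (weightMeasure ω) p fun x => ellNorm r fun k => g k x) :
    MaximalBounded (ENNReal.ofReal p) r ω := by
  have hp0 : 0 < p := by linarith
  have hr0 : 0 < r := by linarith
  have h1p : 0 < 1 / p := by positivity
  set ν := weightMeasure ω with hν
  -- the number of grids, and the loss in the height from summing over them
  set M : ℝ≥0∞ := (Fintype.card (Finset (Fin n)) : ℝ≥0∞) with hM
  have hM0 : M ≠ 0 := by simp [hM]
  have hMt : M ≠ ⊤ := ENNReal.natCast_ne_top _
  set c : ℝ≥0∞ := 12 ^ n * M ^ (1 / r) with hc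
  have hc0 : c ≠ 0 := mul_ne_zero (by simp) (by simp [ENNReal.rpow_eq_zero_iff, hM0, hMt])
  have hct : c ≠ ⊤ := ENNReal.mul_ne_top (by simp)
    (ENNReal.rpow_ne_top_of_nonneg (by positivity) hMt)
  set B : ℝ≥0∞ := M ^ (1 / p) * (c * C) with hB
  have hBt : B ≠ ⊤ := ENNReal.mul_ne_top (ENNReal.rpow_ne_top_of_nonneg h1p.le hMt)
    (ENNReal.mul_ne_top hct hCt)
  have htrunc : ∀ (g : ℕ → (Fin n → ℝ) → ℝ≥0∞), (∀ k, Measurable (g k)) →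
      ∀ (N : ℕ) (lam : ℝ≥0∞), lam ≠ 0 → lam ≠ ⊤ →
        lam * ν {x | lam ^ r < ∑' k, truncMaximal N (g k) x ^ r} ^ (1 / p) ≤
          B * lorentzOne ν p fun x => ellNorm r fun k => g k x := by
    intro g hg N lam hl0 hlt
    set L := lorentzOne ν p fun x => ellNorm r fun k => g k x with hL
    set H : Finset (Fin n) → Set (Fin n → ℝ) := fun S => {x | (lam / c) ^ r <
      ∑' k, (dyadicGrid N (thirdShift N S)).maxAvg volume 0 (2 * N) (g k) x ^ r} with hH
    have hlc0 : lam / c ≠ 0 := ENNReal.div_ne_zero.2 ⟨hl0, hct⟩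
    have hlct : lam / c ≠ ⊤ := ENNReal.div_ne_top hlt hc0
    have hsub : {x | lam ^ r < ∑' k, truncMaximal N (g k) x ^ r} ⊆
        ⋃ S ∈ (Finset.univ : Finset (Finset (Fin n))), H S := by
      intro x (hx : lam ^ r < ∑' k, truncMaximal N (g k) x ^ r)
      by_contra hcon
      simp only [mem_iUnion, Finset.mem_univ, exists_prop, true_and, not_exists] at hcon
      have hcon' : ∀ S, ∑' k, (dyadicGrid N (thirdShift N S)).maxAvg volume 0 (2 * N)
          (g k) x ^ r ≤ (lam / c) ^ r := fun S => not_lt.1 (hcon S)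
      refine absurd hx (not_lt.2 ?_)
      calc ∑' k, truncMaximal N (g k) x ^ r
          ≤ ∑' k, ∑ S : Finset (Fin n), (12 ^ n *
              (dyadicGrid N (thirdShift N S)).maxAvg volume 0 (2 * N) (g k) x) ^ r :=
            ENNReal.tsum_le_tsum fun k => truncMaximal_rpow_le hr0 N (g k) x
        _ = ∑ S : Finset (Fin n), ((12 : ℝ≥0∞) ^ n) ^ r * ∑' k,
              (dyadicGrid N (thirdShift N S)).maxAvg volume 0 (2 * N) (g k) x ^ r := by
            rw [Summable.tsum_finsetSum fun _ _ => ENNReal.summable]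
            refine Finset.sum_congr rfl fun S _ => ?_
            rw [← ENNReal.tsum_mul_left]
            exact tsum_congr fun k => ENNReal.mul_rpow_of_nonneg _ _ hr0.le
        _ ≤ ∑ S : Finset (Fin n), ((12 : ℝ≥0∞) ^ n) ^ r * (lam / c) ^ r :=
            Finset.sum_le_sum fun S _ => mul_le_mul_right (hcon' S) _
        _ = (c * (lam / c)) ^ r := by
            rw [Finset.sum_const, nsmul_eq_mul, Finset.card_univ, ← hM,
              ENNReal.mul_rpow_of_nonneg c _ hr0.le, hc, ENNReal.mul_rpow_of_nonneg (12 ^ n) _ hr0.le,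
              ← ENNReal.rpow_mul, one_div_mul_cancel hr0.ne', ENNReal.rpow_one, ← mul_assoc,
              mul_comm M]
        _ = lam ^ r := by rw [ENNReal.mul_div_cancel hc0 hct]
    have hone : ∀ S, lam ^ p * ν (H S) ≤ (c * C * L) ^ p := by
      intro S
      have h1 := hC N (thirdShift N S) g hg (2 * N) (lam / c) hlc0 hlct
      have h2 : lam * ν (H S) ^ (1 / p) ≤ c * C * L := by
        calc lam * ν (H S) ^ (1 / p) = c * (lam / c * ν (H S) ^ (1 / p)) := by
              rw [← mul_assoc, ENNReal.mul_div_cancel hc0 hct]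
          _ ≤ c * (C * L) := mul_le_mul_right h1 _
          _ = _ := by ring
      have h3 := ENNReal.rpow_le_rpow h2 hp0.le
      rwa [ENNReal.mul_rpow_of_nonneg _ _ hp0.le, ← ENNReal.rpow_mul, one_div_mul_cancel hp0.ne',
        ENNReal.rpow_one] at h3
    have hall : lam ^ p * ν {x | lam ^ r < ∑' k, truncMaximal N (g k) x ^ r} ≤
        M * (c * C * L) ^ p := by
      calc lam ^ p * ν {x | lam ^ r < ∑' k, truncMaximal N (g k) x ^ r}
          ≤ lam ^ p * ∑ S : Finset (Fin n), ν (H S) :=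
            mul_le_mul_right ((measure_mono hsub).trans (measure_biUnion_finset_le _ _)) _
        _ = ∑ S : Finset (Fin n), lam ^ p * ν (H S) := Finset.mul_sum _ _ _
        _ ≤ ∑ S : Finset (Fin n), (c * C * L) ^ p := Finset.sum_le_sum fun S _ => hone S
        _ = _ := by rw [Finset.sum_const, nsmul_eq_mul, Finset.card_univ]
    have h4 := ENNReal.rpow_le_rpow hall h1p.le
    rw [ENNReal.mul_rpow_of_nonneg _ _ h1p.le, ENNReal.mul_rpow_of_nonneg _ _ h1p.le,
      ← ENNReal.rpow_mul, ← ENNReal.rpow_mul, mul_one_div_cancel hp0.ne', ENNReal.rpow_one,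
      ENNReal.rpow_one] at h4
    refine h4.trans_eq ?_
    rw [hB]
    ring
  refine ⟨B.toNNReal + 1, by positivity, fun f hf => ?_⟩
  have hfm := hf.1
  -- measurable representatives of the moduli `|f k|`
  set g : ℕ → (Fin n → ℝ) → ℝ≥0∞ := fun k x => ‖(hfm k).mk (f k) x‖ₑ with hg
  have hgm : ∀ k, Measurable (g k) := fun k => (hfm k).measurable_mk.enorm
  have hgf : ∀ k, (fun x => ‖f k x‖ₑ) =ᵐ[volume] g k := by
    intro k
    filter_upwards [(hfm k).ae_eq_mk] with x hx
    rw [hg, hx]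
  have hmax : ∀ k x, maximal (f k) x = ⨆ N, truncMaximal N (g k) x := by
    intro k x
    rw [iSup_truncMaximal, maximal]
    refine iSup_congr fun h => iSup_congr fun _ => ?_
    rw [lintegral_congr_ae (ae_restrict_of_ae (hgf k))]
  have hnorm : vectorLorentzNorm (ENNReal.ofReal p) 1 r ω f =
      lorentzNorm ν (ENNReal.ofReal p) 1 fun x => ellNorm r fun k => g k x := by
    refine lorentzNorm_congr_ae ?_ _ _
    refine (weightMeasure_absolutelyContinuous ω).ae_eq ?_
    filter_upwards [ae_all_iff.2 hgf] with x hx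
    simp only [hx]
  have hBC : B ≤ ((B.toNNReal + 1 : ℝ≥0) : ℝ≥0∞) := by
    rw [ENNReal.coe_add, ENNReal.coe_toNNReal hBt]
    exact le_self_add
  refine lorentzNorm_top_le (by rw [toReal_one_div_ofReal hp0]; exact h1p) fun lam hl0 hlt => ?_
  rw [toReal_one_div_ofReal hp0, hnorm]
  have hset : {x | lam < ellNorm r fun k => maximal (f k) x} =
      ⋃ N, {x | lam ^ r < ∑' k, truncMaximal N (g k) x ^ r} := by
    ext x
    rw [mem_iUnion]
    change lam < ellNorm r (fun k => maximal (f k) x) ↔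
      ∃ N, lam ^ r < ∑' k, truncMaximal N (g k) x ^ r
    rw [← ENNReal.rpow_lt_rpow_iff hr0, ellNorm_rpow hr0]
    have hpow : ∀ k, maximal (f k) x ^ r = ⨆ N, truncMaximal N (g k) x ^ r := by
      intro k
      rw [hmax]
      exact (ENNReal.orderIsoRpow r hr0).map_iSup _
    simp_rw [hpow]
    constructor
    · intro h
      rw [ENNReal.tsum_eq_iSup_sum, lt_iSup_iff] at h
      obtain ⟨s, hs⟩ := h
      rw [ENNReal.finsetSum_iSup_of_monotone fun k N N' hN =>
        ENNReal.rpow_le_rpow (truncMaximal_mono (g k) x hN) hr0.le, lt_iSup_iff] at hs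
      obtain ⟨N, hN⟩ := hs
      exact ⟨N, hN.trans_le (ENNReal.sum_le_tsum s)⟩
    · rintro ⟨N, hN⟩
      exact hN.trans_le (ENNReal.tsum_le_tsum fun k =>
        le_iSup (fun N => truncMaximal N (g k) x ^ r) N)
  have hmono : Monotone fun N => {x | lam ^ r < ∑' k, truncMaximal N (g k) x ^ r} := by
    intro N N' hN x hx
    exact lt_of_lt_of_le hx (ENNReal.tsum_le_tsum fun k =>
      ENNReal.rpow_le_rpow (truncMaximal_mono (g k) x hN) hr0.le)
  rw [hset, hmono.measure_iUnion]
  have hsup : (⨆ N, ν {x | lam ^ r < ∑' k, truncMaximal N (g k) x ^ r}) ^ (1 / p) =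
      ⨆ N, ν {x | lam ^ r < ∑' k, truncMaximal N (g k) x ^ r} ^ (1 / p) :=
    (ENNReal.orderIsoRpow (1 / p) h1p).map_iSup _
  rw [hsup, ENNReal.mul_iSup]
  refine iSup_le fun N => (htrunc g hgm N lam hl0 hlt).trans ?_
  exact mul_le_mul' hBC (lorentzOne_le_lorentzNorm hp0)

end Dyadic

end WeightedLorentz

end

theorem mainTheorem4 {n : ℕ} (hn : 0 < n) {p r : ℝ} (hp : 1 < p) (hr : 1 < r)
    {ω : (Fin n → ℝ) → ℝ} (hω : WeightedLorentz.IsWeight ω) :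
    (WeightedLorentz.MaximalBounded (ENNReal.ofReal p) r ω →
      WeightedLorentz.MemA (ENNReal.ofReal p) 1 ω) ∧
    ((∀ᵐ x ∂(volume : Measure (Fin n → ℝ)), 0 < ω x) →
      ((∃ q : ℝ, 1 < q ∧ q < p ∧ WeightedLorentz.MemA (ENNReal.ofReal q) 1 ω) →
        WeightedLorentz.MaximalBounded (ENNReal.ofReal p) r ω) ∧
      (p < r → WeightedLorentz.MemA (ENNReal.ofReal p) 1 ω →
        WeightedLorentz.MaximalBounded (ENNReal.ofReal p) r ω)) := by
  have hD1 : (1 : ℝ≥0∞) ≤ 2 ^ n := one_le_pow₀ one_le_two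
  have hDt : (2 : ℝ≥0∞) ^ n ≠ ⊤ := by simp
  refine ⟨WeightedLorentz.memA_of_maximalBounded hω hp hr, fun hpos => ⟨?_, ?_⟩⟩
  · rintro ⟨q, hq, hqp, hA⟩
    obtain ⟨K, hKt, hK⟩ := hA.exists_comparable_dyadicGrid hω hpos hq
    obtain ⟨C, hCt, hC⟩ :=
      WeightedLorentz.Grid.exists_weak_bound_of_comparable_lt hq hqp hr hKt hD1 hDt
    exact WeightedLorentz.maximalBounded_of_grid hp hr hCt fun N τ =>
      hC _ _ _ _ _ (hK N τ) (WeightedLorentz.charged_volume_dyadicGrid N τ)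
        (WeightedLorentz.charged_weightMeasure_dyadicGrid hω hpos N τ)
        (WeightedLorentz.volume_cell_le_dyadicGrid N τ)
  · intro hpr hA
    obtain ⟨K, hKt, hK⟩ := hA.exists_comparable_dyadicGrid hω hpos hp
    obtain ⟨C, hCt, hC⟩ := WeightedLorentz.Grid.exists_weak_bound_of_lt hp hpr hKt hD1 hDt
    exact WeightedLorentz.maximalBounded_of_grid hp hr hCt fun N τ =>
      hC _ _ _ _ _ (hK N τ) (WeightedLorentz.charged_volume_dyadicGrid N τ)
        (WeightedLorentz.charged_weightMeasure_dyadicGrid hω hpos N τ)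
        (WeightedLorentz.volume_cell_le_dyadicGrid N τ)
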